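/- Let $W(y|x)$ be a discrete channel with input alphabet $\{0,1\}$. Write $I(W)$ for its mutual information (in bits) under a uniform input and $Z(W)=\sum_y\sqrt{W(y|0)W(y|1)}$ for its Bhattacharyya parameter, and assume $Z(W)>0$ (equivalently, $I(W)<1$). For $j=1,\dots,s$ let $T_{l_j}$ be an invertible $l_j\times l_j$ matrix over $\mathbb F_2$ (a kernel), $l_j\ge 2$, with rows $t_1,\dots,t_{l_j}$, partial distances $D_i=\mathrm{dist}(t_i,\langle t_{i+1},\dots,t_{l_j}\rangle)$ (Hamming distance to the linear span) and error exponent $E_{l_j}=\frac1{l_j}\sum_{i=1}^{l_j}\log_{l_j}D_i$. Let $T^{(1)},T^{(2)},\dots$ be a sequence of kernels, each $T^{(k)}$ one of the $T_{l_j}$, of size $n_k\times n_k$, in which $T_{l_j}$ has asymptotic frequency $p_j$: $\frac1m\#\{k\le m: T^{(k)} \text{ is the } j\text{-th kernel}\}\to p_j$ as $m\to\infty$. Put $N=N_m=\prod_{k\le m}n_k$ and $G_N=T^{(1)}\otimes\cdots\otimes T^{(m)}$. For an index $i\in\{1,\dots,N\}$ with mixed radix digits $(b_1,\dots,b_m)$,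 $b_k\in\{1,\dots,n_k\}$, $b_1$ most significant, let $$W_{b_1,\dots,b_m}(y_1^N,u_1^{i-1}\,|\,u_i)=\frac1{2^{N-1}}\sum_{u_{i+1}^N\in\{0,1\}^{N-i}}\ \prod_{j=1}^N W\big(y_j\,|\,(u_1^N G_N)_j\big).$$ Let $B_1,B_2,\dots$ be independent, $B_k$ uniform on $\{1,\dots,n_k\}$, and let $Z_m=Z(W_{B_1,\dots,B_m})$. Then the multi-kernel polar code has rate of convergence $$E=\sum_{j=1}^s\frac{p_j\log_2 l_j}{\sum_{j'=1}^s p_{j'}\log_2 l_{j'}}\,E_{l_j},$$ that is: for every $\gamma>E$, $\ \lim_{m\to\infty}\mathbb P\big(Z_m\ge 2^{-N^\gamma}\big)=1$; and for every $0<\gamma<E$, $\ \lim_{m\to\infty}\mathbb P\big(Z_m\le 2^{-N^\gamma}\big)=I(W)$. -/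

import Mathlib

open MeasureTheory ProbabilityTheory Filter Topology
open scoped Matrix

noncomputable section

namespace MultiKernelPolar

/-- `W x y` is the transition probability `W(y|x)` of a discrete channel with binary input `x`:
for every input it is a probability mass function on the output alphabet `Y`. -/
structure IsBinaryChannel {Y : Type*} (W : ZMod 2 → Y → ℝ) : Prop where
  nonneg : ∀ x y, 0 ≤ W x y
  hasSum_one : ∀ x, HasSum (W x) 1

/-- The mutual information `I(W) = I(X;Y)` in bits, for a uniformly distributed binary input `X`. -/
def mutualInfo {Y : Type*} (W : ZMod 2 → Y → ℝ) : ℝ :=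
  ∑' y, ∑ x : ZMod 2, 1 / 2 * W x y * Real.logb 2 (W x y / (1 / 2 * W 0 y + 1 / 2 * W 1 y))

/-- The Bhattacharyya parameter `Z(W) = ∑ y, √(W(y|1) W(y|0))`. -/
def bhattacharyya {Y : Type*} (W : ZMod 2 → Y → ℝ) : ℝ :=
  ∑' y, √(W 1 y * W 0 y)

/-- The virtual channel with input `u_i` and output `(y, (u_j)_{j < i})`, when the bits `u` are
independent and uniform, `x = u G` is transmitted over independent copies of `W`, and `y` is
received. Its transition probability is the sum, over all completions of `(u_j)_{j ≤ i}` to a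
vector `u`, of `2^{-(N-1)} ∏ j, W(y_j | (u G)_j)`, with `N` the size of the index set. -/
def virtualChannel {ι Y : Type*} [Fintype ι] [LinearOrder ι] (W : ZMod 2 → Y → ℝ)
    (G : Matrix ι ι (ZMod 2)) (i : ι) :
    ZMod 2 → (ι → Y) × ({j : ι // j < i} → ZMod 2) → ℝ :=
  fun x z => ∑ u : ι → ZMod 2 with (u i = x ∧ ∀ j : {j : ι // j < i}, u j = z.2 j),
    (1 / 2 : ℝ) ^ (Fintype.card ι - 1) * ∏ j, W ((u ᵥ* G) j) (z.1 j)

/-- Mixed radix numbers with `m` digits, the `k`-th digit in base `l k`, and the digit of index `0`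
the most significant one: the order is the lexicographic one. -/
abbrev MixedRadix (l : ℕ → ℕ) (m : ℕ) : Type := Πₗ k : Fin m, Fin (l k)

/-- The Kronecker product `T 0 ⊗ T 1 ⊗ ⋯ ⊗ T (m - 1)`, with rows and columns indexed by mixed radix
numbers. -/
def transformMatrix {l : ℕ → ℕ} (T : ∀ k, Matrix (Fin (l k)) (Fin (l k)) (ZMod 2)) (m : ℕ) :
    Matrix (MixedRadix l m) (MixedRadix l m) (ZMod 2) :=
  Matrix.of fun b c => ∏ k : Fin m, T k (ofLex b k) (ofLex c k)

/-- The length `N` of the code after `m` steps. -/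
def blockLength (l : ℕ → ℕ) (m : ℕ) : ℕ := ∏ k : Fin m, l k

/-- The random Bhattacharyya parameter `Z_m = Z(W_{B_1, …, B_m})`. -/
def bhattacharyyaProcess {Y Ω : Type*} (W : ZMod 2 → Y → ℝ) {l : ℕ → ℕ}
    (T : ∀ k, Matrix (Fin (l k)) (Fin (l k)) (ZMod 2)) (B : ∀ k, Ω → Fin (l k)) (m : ℕ) (ω : Ω) :
    ℝ :=
  bhattacharyya (virtualChannel W (transformMatrix T m) (toLex fun k : Fin m => B k ω))

/-- The multi-kernel polar code built from `W` and the kernel sequence `T` has rate of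
convergence `E`, the random indices being `B`. -/
def HasRateOfConvergence {Y Ω : Type*} [MeasurableSpace Ω] (P : Measure Ω) (W : ZMod 2 → Y → ℝ)
    {l : ℕ → ℕ} (T : ∀ k, Matrix (Fin (l k)) (Fin (l k)) (ZMod 2)) (B : ∀ k, Ω → Fin (l k))
    (E : ℝ) : Prop :=
  (∀ γ : ℝ, E < γ → Tendsto (fun m : ℕ => P.real
    {ω | (2 : ℝ) ^ (-((blockLength l m : ℝ) ^ γ)) ≤ bhattacharyyaProcess W T B m ω})
    atTop (𝓝 1)) ∧
  (∀ γ : ℝ, 0 < γ → γ < E → Tendsto (fun m : ℕ => P.real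
    {ω | bhattacharyyaProcess W T B m ω ≤ (2 : ℝ) ^ (-((blockLength l m : ℝ) ^ γ))})
    atTop (𝓝 (mutualInfo W)))

/-- The partial distance `D_i`: the Hamming distance of row `i` to the code spanned by the rows
below it. -/
def partialDistance {n : ℕ} (T : Matrix (Fin n) (Fin n) (ZMod 2)) (i : Fin n) : ℕ :=
  sInf ((fun c => hammingDist (T.row i) c) ''
    (Submodule.span (ZMod 2) (T.row '' Set.Ioi i) : Set (Fin n → ZMod 2)))

/-- The error exponent `(1/n) ∑ i, log_n D_i` of an `n × n` kernel. -/
def errorExponent {n : ℕ} (T : Matrix (Fin n) (Fin n) (ZMod 2)) : ℝ :=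
  1 / (n : ℝ) * ∑ i, Real.logb n (partialDistance T i)

end MultiKernelPolar

end

namespace MultiKernelPolar

/-! ### The entropy function of a pair of masses -/

/-! One kernel step at index `i` changes the Bhattacharyya parameter `Z` to a value between `Z ^
D_i` and `2 ^ n * Z ^ D_i`. So, up to bounded additive errors, `-log Z_m` is multiplied at each step
by the partial distance of the random digit. By the law of large numbers and the frequencies `p j`,
`log₂` of the product of these distances grows like `m E Λ`, where `Λ = ∑ p_j log₂ l_j`, while `log₂
N` grows like `m Λ`. This compares `-log₂ Z_m` with `N ^ γ`.

The lower bound on `Z` carries no constant, so for `γ > E` the argument works on almost every path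
(`eventually_two_rpow_neg_le`). For `γ < E` the factor `2 ^ n` is harmless only once `Z` is small.
On paths with `Z_m → 0` it costs an arbitrarily small `ε` in each partial distance
(`eventually_le_two_rpow_neg`).

It remains to find the probability of `Z_m → 0`, which is polarization. The chain rule and
invertibility of the kernels make the mutual information a bounded martingale
(`IsBinaryChannel.sum_condEntropy_virtualChannel`), so it converges. If `E > 0`, a kernel with a
partial distance at least two is used infinitely often. Such a kernel has a row whose input bit is
seen at two outputs undisturbed by later bits (`exists_two_columns`), and the second observation
raises the information by a definite amount
(`IsBinaryChannel.condEntropy_virtualChannel_le_of_columns`). Hence the limit is `0` or `1`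
(`exists_ae_tendsto_zero_or_one`), and it is `1` with probability equal to its mean `I(W)`. Limit
`1` forces `Z_m → 0`; limit `0` keeps `Z_m` away from zero. All this is applied step by step because
the virtual channel of a Kronecker product is an iterated virtual channel
(`exists_equiv_virtualChannel_kronecker`). -/

/-- The unnormalized entropy `(a + b) h(a / (a + b))`, in nats, of a pair of masses. -/
noncomputable def pairEntropy (a b : ℝ) : ℝ :=
  Real.negMulLog a + Real.negMulLog b - Real.negMulLog (a + b)

lemma pairEntropy_comm (a b : ℝ) : pairEntropy a b = pairEntropy b a := by
  unfold pairEntropy; rw [add_comm a b]; ring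

@[simp] lemma pairEntropy_zero_left (b : ℝ) : pairEntropy 0 b = 0 := by simp [pairEntropy]

@[simp] lemma pairEntropy_zero_right (a : ℝ) : pairEntropy a 0 = 0 := by simp [pairEntropy]

lemma pairEntropy_mul_left (r a b : ℝ) : pairEntropy (r * a) (r * b) = r * pairEntropy a b := by
  unfold pairEntropy
  rw [← mul_add, Real.negMulLog_mul, Real.negMulLog_mul, Real.negMulLog_mul]; ring

lemma continuous_pairEntropy : Continuous fun v : ℝ × ℝ => pairEntropy v.1 v.2 := by
  unfold pairEntropy
  have := Real.continuous_negMulLog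
  fun_prop

/-- This is `log t ≤ t - 1` at `t = √(m / b)`. Taking the root first makes relative entropy dominate
a squared Hellinger distance, the quantity measured by the Bhattacharyya parameter. -/
lemma sqrt_sub_le_mul_log {b m : ℝ} (hb : 0 ≤ b) (hm : 0 < m) :
    2 * (b - √b * √m) ≤ b * Real.log b - b * Real.log m := by
  rcases hb.eq_or_lt with rfl | hb
  · simp
  have hb' := Real.sqrt_pos.2 hb
  have hm' := Real.sqrt_pos.2 hm
  have h1 : Real.log (√m / √b) ≤ √m / √b - 1 := Real.log_le_sub_one_of_pos (by positivity)
  rw [Real.log_div hm'.ne' hb'.ne', Real.log_sqrt hm.le, Real.log_sqrt hb.le] at h1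
  have h2 : b * (√m / √b) = √b * √m := by
    nth_rewrite 1 [← Real.mul_self_sqrt hb.le]
    field_simp
  nlinarith [mul_le_mul_of_nonneg_left h1 hb.le]

/-- A sharpened Gibbs inequality. -/
lemma pairEntropy_le_of_add_eq_one {p q b c : ℝ} (hp : 0 < p) (hq : 0 < q) (hpq : p + q = 1)
    (hb : 0 ≤ b) (hc : 0 ≤ c) :
    pairEntropy (p * b) (q * c) ≤
      -(p * b) * Real.log p - q * c * Real.log q - p * q * (√b - √c) ^ 2 := by
  rcases hb.eq_or_lt with rfl | hb0
  · have h1 : Real.log q ≤ q - 1 := Real.log_le_sub_one_of_pos hq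
    have h2 := mul_le_mul_of_nonneg_left h1 (mul_nonneg hq.le hc)
    have h3 : p * q * (√0 - √c) ^ 2 = q * c * (1 - q) := by
      rw [Real.sqrt_zero, zero_sub, neg_sq, Real.sq_sqrt hc, ← hpq]; ring
    rw [h3, mul_zero, pairEntropy_zero_left]
    nlinarith
  have hm : 0 < p * b + q * c := by positivity
  have e : pairEntropy (p * b) (q * c) = -(p * b) * Real.log p - q * c * Real.log q
      - (p * (b * Real.log b - b * Real.log (p * b + q * c))
        + q * (c * Real.log c - c * Real.log (p * b + q * c))) := by
    unfold pairEntropy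
    rw [Real.negMulLog_mul, Real.negMulLog_mul]
    simp only [Real.negMulLog]
    ring
  have h1 := mul_le_mul_of_nonneg_left (sqrt_sub_le_mul_log hb hm) hp.le
  have h2 := mul_le_mul_of_nonneg_left (sqrt_sub_le_mul_log hc hm) hq.le
  have h3 := Real.sq_sqrt hb
  have h4 := Real.sq_sqrt hc
  have h5 := Real.sq_sqrt hm.le
  set m := p * b + q * c
  -- With `s = p√b + q√c`, the weighted sum of the two bounds is `2(m - √m s) ≥ m - s ^ 2`. The
  -- right side is the variance of a two-point distribution, computed here.
  have h6 : p * q * (√b - √c) ^ 2 = m - (p * √b + q * √c) ^ 2 := by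
    have : m = p * b + q * c := rfl
    rw [this, ← h3, ← h4]
    have : q = 1 - p := by linarith
    rw [this]; simp only [h3, h4]; rw [← h3, ← h4]; ring_nf
    simp only [h3, h4]; ring
  have h7 := sq_nonneg (√m - (p * √b + q * √c))
  rw [e, h6]
  have h8 : m = p * b + q * c := rfl
  nlinarith

lemma pairEntropy_nonneg {a b : ℝ} (ha : 0 ≤ a) (hb : 0 ≤ b) : 0 ≤ pairEntropy a b := by
  rcases ha.eq_or_lt with rfl | ha
  · simp
  rcases hb.eq_or_lt with rfl | hb
  · simp
  have h1 : Real.log a ≤ Real.log (a + b) := Real.log_le_log ha (by linarith)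
  have h2 : Real.log b ≤ Real.log (a + b) := Real.log_le_log hb (by linarith)
  simp only [pairEntropy, Real.negMulLog]
  nlinarith

/-- `log t ≤ t - 1` at both posterior probabilities. The quotient `a b / (a + b)` mediates between
entropy and Bhattacharyya parameter, through `IsBinaryChannel.sq_bhattacharyya_le`. -/
lemma two_mul_div_le_pairEntropy {a b : ℝ} (ha : 0 ≤ a) (hb : 0 ≤ b) :
    2 * (a * b / (a + b)) ≤ pairEntropy a b := by
  rcases ha.eq_or_lt with rfl | ha
  · simp
  rcases hb.eq_or_lt with rfl | hb
  · simp
  have h1 : Real.log (a / (a + b)) ≤ a / (a + b) - 1 := Real.log_le_sub_one_of_pos (by positivity)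
  have h2 : Real.log (b / (a + b)) ≤ b / (a + b) - 1 := Real.log_le_sub_one_of_pos (by positivity)
  have hs : 0 < a + b := by positivity
  rw [Real.log_div ha.ne' hs.ne'] at h1
  rw [Real.log_div hb.ne' hs.ne'] at h2
  have e : a * (a / (a + b) - 1) + b * (b / (a + b) - 1) = -(2 * (a * b / (a + b))) := by
    field_simp; ring
  simp only [pairEntropy, Real.negMulLog]
  nlinarith [mul_le_mul_of_nonneg_left h1 ha.le, mul_le_mul_of_nonneg_left h2 hb.le]

lemma pairEntropy_le_mul_log_two {a b : ℝ} (ha : 0 ≤ a) (hb : 0 ≤ b) :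
    pairEntropy a b ≤ (a + b) * Real.log 2 := by
  have := pairEntropy_le_of_add_eq_one (p := 1 / 2) (q := 1 / 2) (b := 2 * a) (c := 2 * b)
    (by norm_num) (by norm_num) (by norm_num) (by linarith) (by linarith)
  have e : Real.log (1 / 2) = - Real.log 2 := by simp
  rw [e] at this
  have h2 := sq_nonneg (√(2 * a) - √(2 * b))
  ring_nf at this h2 ⊢
  nlinarith

/-- The same tangent bound, at the ratios of the posteriors to `1 / 2`. It is sharp for nearly
useless channels, where the previous comparison says little. -/
lemma mul_log_two_sub_pairEntropy_le {a b : ℝ} (ha : 0 ≤ a) (hb : 0 ≤ b) :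
    (a + b) * Real.log 2 - pairEntropy a b ≤ (a + b) - 4 * (a * b / (a + b)) := by
  have key : ∀ x s : ℝ, 0 ≤ x → 0 < s →
      x * Real.log x - x * Real.log s + x * Real.log 2 ≤ x * (2 * x / s - 1) := by
    intro x s hx hs
    rcases hx.eq_or_lt with rfl | hx
    · simp
    have h1 : Real.log (2 * x / s) ≤ 2 * x / s - 1 :=
      Real.log_le_sub_one_of_pos (by positivity)
    rw [Real.log_div (by positivity) hs.ne', Real.log_mul (by norm_num) hx.ne'] at h1
    nlinarith [mul_le_mul_of_nonneg_left h1 hx.le]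
  rcases (add_nonneg ha hb).eq_or_lt with h0 | hs
  · have : a = 0 := by linarith
    have : b = 0 := by linarith
    subst_vars; simp
  have h1 := key a _ ha hs
  have h2 := key b _ hb hs
  have e : a * (2 * a / (a + b) - 1) + b * (2 * b / (a + b) - 1)
      = (a + b) - 4 * (a * b / (a + b)) := by
    field_simp; ring
  simp only [pairEntropy, Real.negMulLog]
  nlinarith

/-- With `x = √a`, `y = √b`, `r = √(a + b)`, the root bound gives `2 r (x + y - r)`. Since `r ≤ x +
y`, this is at most `(x + y) ^ 2 - r ^ 2 = 2 x y`. -/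
lemma pairEntropy_le_two_mul_sqrt {a b : ℝ} (ha : 0 ≤ a) (hb : 0 ≤ b) :
    pairEntropy a b ≤ 2 * √(a * b) := by
  rcases (add_nonneg ha hb).eq_or_lt with h0 | hs
  · have : a = 0 := by linarith
    have : b = 0 := by linarith
    subst_vars; simp
  have h1 := sqrt_sub_le_mul_log ha hs
  have h2 := sqrt_sub_le_mul_log hb hs
  rw [Real.sqrt_mul ha]
  have e1 := Real.sq_sqrt ha
  have e2 := Real.sq_sqrt hb
  have e3 := Real.sq_sqrt hs.le
  have n1 := Real.sqrt_nonneg a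
  have n2 := Real.sqrt_nonneg b
  have n3 := Real.sqrt_pos.2 hs
  set x := √a
  set y := √b
  set r := √(a + b)
  have h3 : pairEntropy a b ≤ 2 * (r * (x + y) - (a + b)) := by
    simp only [pairEntropy, Real.negMulLog]; nlinarith
  have h4 : r ≤ x + y := by
    refine abs_le_of_sq_le_sq' ?_ (by positivity) |>.2
    nlinarith [mul_nonneg n1 n2]
  have h5 : r * (x + y) - r ^ 2 ≤ x * y := by
    have : (x + y) ^ 2 = r ^ 2 + 2 * (x * y) := by nlinarith
    nlinarith
  linarith

/-- Superadditivity of the entropy function. -/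
lemma pairEntropy_add_le {a b c d : ℝ} (ha : 0 ≤ a) (hb : 0 ≤ b) (hc : 0 ≤ c) (hd : 0 ≤ d) :
    pairEntropy a b + pairEntropy c d ≤ pairEntropy (a + c) (b + d) := by
  rcases (add_nonneg ha hc).eq_or_lt with h0 | hA
  · have : a = 0 := by linarith
    have : c = 0 := by linarith
    subst_vars; simp
  rcases (add_nonneg hb hd).eq_or_lt with h0 | hB
  · have : b = 0 := by linarith
    have : d = 0 := by linarith
    subst_vars; simp
  set A := a + c
  set B := b + d
  have hS : 0 < A + B := by positivity
  -- The right side is the tangent plane of `pairEntropy` at `(A, B)`. It is linear in `(u, v)` and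
  -- touches at `(A, B)`, so adding the bounds for the two summands suffices.
  have key : ∀ u v : ℝ, 0 ≤ u → 0 ≤ v → pairEntropy u v ≤
      u * (Real.log (A + B) - Real.log A) + v * (Real.log (A + B) - Real.log B) := by
    intro u v hu hv
    have := pairEntropy_le_of_add_eq_one (p := A / (A + B)) (q := B / (A + B))
      (b := u * (A + B) / A) (c := v * (A + B) / B) (by positivity) (by positivity)
      (by field_simp) (by positivity) (by positivity)
    have e1 : A / (A + B) * (u * (A + B) / A) = u := by field_simp
    have e2 : B / (A + B) * (v * (A + B) / B) = v := by field_simp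
    rw [e1, e2, Real.log_div hA.ne' hS.ne', Real.log_div hB.ne' hS.ne'] at this
    have h3 : 0 ≤ A / (A + B) * (B / (A + B)) * (√(u * (A + B) / A) - √(v * (A + B) / B)) ^ 2 := by
      positivity
    linarith
  have h1 := key a b ha hb
  have h2 := key c d hc hd
  have e : pairEntropy A B = A * (Real.log (A + B) - Real.log A)
      + B * (Real.log (A + B) - Real.log B) := by
    simp only [pairEntropy, Real.negMulLog]; ring
  have e1 : A = a + c := rfl
  have e2 : B = b + d := rfl
  rw [e]
  nlinarith

lemma sum_pairEntropy_le {α : Type*} (s : Finset α) {f g : α → ℝ} (hf : ∀ a, 0 ≤ f a)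
    (hg : ∀ a, 0 ≤ g a) :
    ∑ a ∈ s, pairEntropy (f a) (g a) ≤ pairEntropy (∑ a ∈ s, f a) (∑ a ∈ s, g a) := by
  classical
  induction s using Finset.induction_on with
  | empty => simp
  | insert a s ha ih =>
    rw [Finset.sum_insert ha, Finset.sum_insert ha, Finset.sum_insert ha]
    exact (add_le_add_right ih _).trans (pairEntropy_add_le (hf a) (hg a)
      (Finset.sum_nonneg fun _ _ => hf _) (Finset.sum_nonneg fun _ _ => hg _))

lemma summable_pairEntropy {α : Type*} {f g : α → ℝ} (hf : ∀ a, 0 ≤ f a)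
    (hg : ∀ a, 0 ≤ g a) (hfs : Summable f) (hgs : Summable g) :
    Summable fun a => pairEntropy (f a) (g a) :=
  Summable.of_nonneg_of_le (fun a => pairEntropy_nonneg (hf a) (hg a))
    (fun a => pairEntropy_le_mul_log_two (hf a) (hg a)) ((hfs.add hgs).mul_right _)

lemma tsum_pairEntropy_le {α : Type*} {f g : α → ℝ} {A B : ℝ} (hf : ∀ a, 0 ≤ f a)
    (hg : ∀ a, 0 ≤ g a) (hfA : HasSum f A) (hgB : HasSum g B) :
    ∑' a, pairEntropy (f a) (g a) ≤ pairEntropy A B := by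
  have h := (summable_pairEntropy hf hg hfA.summable hgB.summable).hasSum
  have h2 : Tendsto (fun s : Finset α => pairEntropy (∑ a ∈ s, f a) (∑ a ∈ s, g a))
      atTop (𝓝 (pairEntropy A B)) :=
    (continuous_pairEntropy.tendsto (A, B)).comp (Filter.Tendsto.prodMk_nhds hfA hgB)
  exact le_of_tendsto_of_tendsto' h h2 fun s => sum_pairEntropy_le s hf hg

/-- Merging outputs does not decrease the conditional entropy. -/
lemma tsum_pairEntropy_le_of_fiber {α β : Type*} (π : α → β) {f g : α → ℝ} {F G : β → ℝ}
    (hf : ∀ a, 0 ≤ f a) (hg : ∀ a, 0 ≤ g a) (hfs : Summable f) (hgs : Summable g)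
    (hF : ∀ b, HasSum (fun a => {a | π a = b}.indicator f a) (F b))
    (hG : ∀ b, HasSum (fun a => {a | π a = b}.indicator g a) (G b))
    (hFs : Summable F) (hGs : Summable G) :
    ∑' a, pairEntropy (f a) (g a) ≤ ∑' b, pairEntropy (F b) (G b) := by
  have hF0 : ∀ b, 0 ≤ F b := fun b => (hF b).nonneg fun a => Set.indicator_nonneg (fun _ _ => hf _) _
  have hG0 : ∀ b, 0 ≤ G b := fun b => (hG b).nonneg fun a => Set.indicator_nonneg (fun _ _ => hg _) _
  have hs := summable_pairEntropy hf hg hfs hgs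
  have hs' : Summable fun x : (Σ b, {a // π a = b}) => pairEntropy (f x.2.1) (g x.2.1) :=
    (Equiv.sigmaFiberEquiv π).summable_iff.2 hs
  rw [← (Equiv.sigmaFiberEquiv π).tsum_eq]
  change ∑' x : (Σ b, {a // π a = b}), pairEntropy (f x.2.1) (g x.2.1) ≤ _
  rw [hs'.tsum_sigma]
  refine hs'.sigma.tsum_le_tsum (fun b => ?_) (summable_pairEntropy hF0 hG0 hFs hGs)
  refine tsum_pairEntropy_le (fun _ => hf _) (fun _ => hg _) ?_ ?_
  · exact (hasSum_subtype_iff_indicator (s := {a | π a = b})).2 (hF b)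
  · exact (hasSum_subtype_iff_indicator (s := {a | π a = b})).2 (hG b)

/-! ### Sums over products -/

/-- Fubini for nonnegative terms, one coordinate at a time; the output alphabet may be infinite. -/
lemma hasSum_pi_prod {Y : Type*} {n : ℕ} {f : Fin n → Y → ℝ} {a : Fin n → ℝ}
    (hf : ∀ j y, 0 ≤ f j y) (h : ∀ j, HasSum (f j) (a j)) :
    HasSum (fun y : Fin n → Y => ∏ j, f j (y j)) (∏ j, a j) := by
  induction n with
  | zero => simp
  | succ n ih =>
    have ih := ih (f := fun j : Fin n => f j.succ) (fun j => hf _) (fun j => h j.succ)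
    have h0 := h 0
    have hs := Summable.mul_of_nonneg (f := f 0)
      (g := fun y : Fin n → Y => ∏ j : Fin n, f j.succ (y j)) h0.summable ih.summable
      (fun y => hf 0 y) (fun y => Finset.prod_nonneg fun j _ => hf _ _)
    have := HasSum.mul h0 ih hs
    rw [Fin.prod_univ_succ, ← (Fin.consEquiv fun _ : Fin (n + 1) => Y).hasSum_iff]
    have e : (fun y : Fin (n + 1) → Y => ∏ j, f j (y j)) ∘ (Fin.consEquiv fun _ => Y) =
        fun z => f 0 z.1 * ∏ j : Fin n, f j.succ (z.2 j) := by
      funext z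
      simp [Fin.prod_univ_succ]
    rw [e]
    exact this

lemma hasSum_prod_of_fintype {α β : Type*} [Fintype β] {f : α × β → ℝ} {a : β → ℝ}
    (h : ∀ b, HasSum (fun x => f (x, b)) (a b)) : HasSum f (∑ b, a b) := by
  classical
  have : ∀ b, HasSum (fun z : α × β => if z.2 = b then f z else 0) (a b) := fun b => by
    rw [← (Prod.mk_left_injective b).hasSum_iff]
    · simpa [Function.comp_def] using h b
    · rintro ⟨x, c⟩ hx
      have : c ≠ b := fun hc => hx ⟨x, by rw [hc]⟩
      simp [this]
  convert hasSum_sum fun b (_ : b ∈ Finset.univ) => this b using 2 with z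
  simp

lemma hasSum_sum_of_prod {α β : Type*} [Fintype β] {f : α × β → ℝ} {A : ℝ}
    (h : HasSum f A) : HasSum (fun x => ∑ b, f (x, b)) A :=
  h.prod_fiberwise fun _ => hasSum_fintype _

/-! ### Conditional entropy and Bhattacharyya parameter -/

/-- The conditional entropy `H(X|Y)`, in nats, for a uniformly distributed input `X`. -/
noncomputable def condEntropy {Y : Type*} (W : ZMod 2 → Y → ℝ) : ℝ :=
  ∑' y, pairEntropy (1 / 2 * W 0 y) (1 / 2 * W 1 y)

namespace IsBinaryChannel

variable {Y : Type*} {W : ZMod 2 → Y → ℝ}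

lemma half_nonneg (hW : IsBinaryChannel W) (x : ZMod 2) (y : Y) : 0 ≤ 1 / 2 * W x y :=
  mul_nonneg (by norm_num) (hW.nonneg x y)

lemma hasSum_half (hW : IsBinaryChannel W) (x : ZMod 2) :
    HasSum (fun y => 1 / 2 * W x y) (1 / 2) := by
  simpa only [mul_one] using (hW.hasSum_one x).mul_left (1 / 2)

lemma hasSum_half_add (hW : IsBinaryChannel W) :
    HasSum (fun y => 1 / 2 * W 0 y + 1 / 2 * W 1 y) 1 := by
  have := (hW.hasSum_half 0).add (hW.hasSum_half 1)
  norm_num at this ⊢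
  exact this

lemma hasSum_condEntropy (hW : IsBinaryChannel W) :
    HasSum (fun y => pairEntropy (1 / 2 * W 0 y) (1 / 2 * W 1 y)) (condEntropy W) :=
  (summable_pairEntropy (hW.half_nonneg 0) (hW.half_nonneg 1) (hW.hasSum_half 0).summable
    (hW.hasSum_half 1).summable).hasSum

lemma hasSum_bhattacharyya (hW : IsBinaryChannel W) :
    HasSum (fun y => √(W 1 y * W 0 y)) (bhattacharyya W) := by
  refine (Summable.of_nonneg_of_le (fun _ => Real.sqrt_nonneg _) (fun y => ?_)
    hW.hasSum_half_add.summable).hasSum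
  have h0 := hW.nonneg 0 y
  have h1 := hW.nonneg 1 y
  rw [Real.sqrt_le_left (by positivity)]
  nlinarith [sq_nonneg (W 0 y - W 1 y)]

lemma mutualInfo_eq (hW : IsBinaryChannel W) :
    mutualInfo W = 1 - condEntropy W / Real.log 2 := by
  refine (HasSum.tsum_eq ?_)
  refine (hW.hasSum_half_add.sub (hW.hasSum_condEntropy.div_const (Real.log 2))).congr_fun
    fun y => ?_
  have ha := hW.half_nonneg 0 y
  have hb := hW.half_nonneg 1 y
  have key : ∀ w s : ℝ, 0 ≤ 1 / 2 * w → 1 / 2 * w ≤ s → 1 / 2 * w * Real.logb 2 (w / s) =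
      1 / 2 * w + (1 / 2 * w * Real.log (1 / 2 * w) - 1 / 2 * w * Real.log s) / Real.log 2 := by
    intro w s hw hs
    have h2 : Real.log 2 ≠ 0 := (Real.log_pos one_lt_two).ne'
    rcases hw.eq_or_lt with h0 | hw
    · have : w = 0 := by linarith
      simp [this]
    · have hw' : w ≠ 0 := by rintro rfl; simp at hw
      rw [Real.logb, Real.log_div hw' (by linarith), Real.log_mul (by norm_num) hw',
        Real.log_div one_ne_zero two_ne_zero, Real.log_one]
      field_simp
      ring
  rw [show (Finset.univ : Finset (ZMod 2)) = {0, 1} from rfl, Finset.sum_pair zero_ne_one,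
    key _ _ ha (by linarith), key _ _ hb (by linarith)]
  simp only [pairEntropy, Real.negMulLog]
  ring

lemma condEntropy_nonneg (hW : IsBinaryChannel W) : 0 ≤ condEntropy W :=
  tsum_nonneg fun y => pairEntropy_nonneg (hW.half_nonneg 0 y) (hW.half_nonneg 1 y)

lemma condEntropy_le_log_two (hW : IsBinaryChannel W) : condEntropy W ≤ Real.log 2 := by
  have := hasSum_le (fun y => pairEntropy_le_mul_log_two (hW.half_nonneg 0 y) (hW.half_nonneg 1 y))
    hW.hasSum_condEntropy (hW.hasSum_half_add.mul_right _)
  simpa using this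

lemma bhattacharyya_nonneg (W : ZMod 2 → Y → ℝ) : 0 ≤ bhattacharyya W :=
  tsum_nonneg fun _ => Real.sqrt_nonneg _

lemma bhattacharyya_le_one (hW : IsBinaryChannel W) : bhattacharyya W ≤ 1 := by
  refine hasSum_le (fun y => ?_) hW.hasSum_bhattacharyya hW.hasSum_half_add
  have h0 := hW.nonneg 0 y
  have h1 := hW.nonneg 1 y
  rw [Real.sqrt_le_left (by positivity)]
  nlinarith [sq_nonneg (W 0 y - W 1 y)]

lemma condEntropy_le_bhattacharyya (hW : IsBinaryChannel W) :
    condEntropy W ≤ bhattacharyya W := by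
  refine hasSum_le (fun y => ?_) hW.hasSum_condEntropy hW.hasSum_bhattacharyya
  refine (pairEntropy_le_two_mul_sqrt (hW.half_nonneg 0 y) (hW.half_nonneg 1 y)).trans_eq ?_
  rw [show 1 / 2 * W 0 y * (1 / 2 * W 1 y) = (1 / 2) ^ 2 * (W 1 y * W 0 y) by ring,
    Real.sqrt_mul (by norm_num), Real.sqrt_sq (by norm_num)]
  ring

lemma summable_harmonic (hW : IsBinaryChannel W) :
    Summable fun y => 1 / 2 * W 0 y * (1 / 2 * W 1 y) / (1 / 2 * W 0 y + 1 / 2 * W 1 y) := by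
  refine Summable.of_nonneg_of_le (fun y => ?_) (fun y => ?_) (hW.hasSum_condEntropy.summable)
  · have := hW.half_nonneg 0 y
    have := hW.half_nonneg 1 y
    positivity
  · have h := two_mul_div_le_pairEntropy (hW.half_nonneg 0 y) (hW.half_nonneg 1 y)
    have h0 : 0 ≤ 1 / 2 * W 0 y * (1 / 2 * W 1 y) / (1 / 2 * W 0 y + 1 / 2 * W 1 y) := by
      have := hW.half_nonneg 0 y
      have := hW.half_nonneg 1 y
      positivity
    linarith

/-- Cauchy–Schwarz for `√(a b) = √(a b / (a + b)) * √(a + b)`, the masses `a + b` having total one.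
It is proved termwise by completing a square with the optimal parameter `r = Z(W)`. -/
lemma sq_bhattacharyya_le (hW : IsBinaryChannel W) :
    bhattacharyya W ^ 2 ≤
      4 * ∑' y, 1 / 2 * W 0 y * (1 / 2 * W 1 y) / (1 / 2 * W 0 y + 1 / 2 * W 1 y) := by
  set r := bhattacharyya W with hr
  have h := hasSum_le (fun y => ?_) (hW.hasSum_bhattacharyya.mul_left (r / 2))
    (hW.summable_harmonic.hasSum.add (hW.hasSum_half_add.mul_left (r ^ 2 / 4)))
  · rw [← hr] at h
    nlinarith
  · have ha := hW.half_nonneg 0 y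
    have hb := hW.half_nonneg 1 y
    have e : √(W 1 y * W 0 y) = 2 * √(1 / 2 * W 0 y * (1 / 2 * W 1 y)) := by
      rw [show 1 / 2 * W 0 y * (1 / 2 * W 1 y) = (1 / 2) ^ 2 * (W 1 y * W 0 y) by ring,
        Real.sqrt_mul (by norm_num) (W 1 y * W 0 y), Real.sqrt_sq (by norm_num)]
      ring
    rw [e]
    set a := 1 / 2 * W 0 y
    set b := 1 / 2 * W 1 y
    rcases (add_nonneg ha hb).eq_or_lt with h0 | hs
    · have : a = 0 := by linarith
      simp [this]
      positivity
    · have h1 := Real.sq_sqrt (mul_nonneg ha hb)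
      set q := √(a * b)
      rw [← h1]
      have : q ^ 2 / (a + b) + r ^ 2 / 4 * (a + b) - r / 2 * (2 * q)
          = (q - r / 2 * (a + b)) ^ 2 / (a + b) := by
        field_simp; ring
      have : 0 ≤ (q - r / 2 * (a + b)) ^ 2 / (a + b) := by positivity
      linarith

lemma sq_bhattacharyya_le_two_mul_condEntropy (hW : IsBinaryChannel W) :
    bhattacharyya W ^ 2 ≤ 2 * condEntropy W := by
  have h := hasSum_le
    (fun y => two_mul_div_le_pairEntropy (hW.half_nonneg 0 y) (hW.half_nonneg 1 y))
    (hW.summable_harmonic.hasSum.mul_left 2) hW.hasSum_condEntropy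
  linarith [hW.sq_bhattacharyya_le]

/-- This makes `1 - Z` at least a multiple of the mutual information, as needed to quantify the jump
of the martingale. -/
lemma sq_bhattacharyya_le_one_sub (hW : IsBinaryChannel W) :
    bhattacharyya W ^ 2 ≤ 1 - Real.log 2 + condEntropy W := by
  have h := hasSum_le
    (fun y => mul_log_two_sub_pairEntropy_le (hW.half_nonneg 0 y) (hW.half_nonneg 1 y))
    ((hW.hasSum_half_add.mul_right (Real.log 2)).sub hW.hasSum_condEntropy)
    (hW.hasSum_half_add.sub (hW.summable_harmonic.hasSum.mul_left 4))
  linarith [hW.sq_bhattacharyya_le]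

end IsBinaryChannel

/-! ### Two observations of the same input -/

namespace IsBinaryChannel

variable {Y : Type*} {W : ZMod 2 → Y → ℝ}

lemma hasSum_shift_sqrt (hW : IsBinaryChannel W) (β : ZMod 2) :
    HasSum (fun y => √(W β y) * √(W (β + 1) y)) (bhattacharyya W) := by
  refine hW.hasSum_bhattacharyya.congr_fun fun y => ?_
  rw [Real.sqrt_mul (hW.nonneg _ _)]
  fin_cases β
  · exact mul_comm _ _
  · rfl

/-- The sharpened Gibbs inequality with prior `a : b` leaves a term `(√W β y - √W (β + 1) y) ^ 2`
for each output. These sum to `2 (1 - Z(W))`. -/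
lemma tsum_pairEntropy_mul_le (hW : IsBinaryChannel W) {a b : ℝ} (ha : 0 ≤ a) (hb : 0 ≤ b)
    (β : ZMod 2) :
    ∑' y, pairEntropy (a * W β y) (b * W (β + 1) y) ≤
      pairEntropy a b - 2 * (1 - bhattacharyya W) * (a * b / (a + b)) := by
  rcases ha.eq_or_lt with rfl | ha
  · simp
  rcases hb.eq_or_lt with rfl | hb
  · simp
  have hs : 0 < a + b := by positivity
  have h : ∀ y, pairEntropy (a * W β y) (b * W (β + 1) y) ≤
      (Real.log (a + b) - Real.log a) * a * W β y
      + (Real.log (a + b) - Real.log b) * b * W (β + 1) y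
      - a * b / (a + b) * (W β y + W (β + 1) y - 2 * (√(W β y) * √(W (β + 1) y))) := by
    intro y
    have h0 := hW.nonneg β y
    have h1 := hW.nonneg (β + 1) y
    have := pairEntropy_le_of_add_eq_one (p := a / (a + b)) (q := b / (a + b))
      (b := (a + b) * W β y) (c := (a + b) * W (β + 1) y) (by positivity) (by positivity)
      (by field_simp) (by positivity) (by positivity)
    have e1 : ∀ c w : ℝ, c / (a + b) * ((a + b) * w) = c * w := fun c w => by field_simp
    rw [e1, e1, Real.log_div ha.ne' hs.ne', Real.log_div hb.ne' hs.ne', Real.sqrt_mul hs.le,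
      Real.sqrt_mul hs.le, ← mul_sub, mul_pow, Real.sq_sqrt hs.le, sub_sq, Real.sq_sqrt h0,
      Real.sq_sqrt h1] at this
    have e2 : a / (a + b) * (b / (a + b)) *
        ((a + b) * (W β y - 2 * √(W β y) * √(W (β + 1) y) + W (β + 1) y)) =
        a * b / (a + b) * (W β y + W (β + 1) y - 2 * (√(W β y) * √(W (β + 1) y))) := by
      field_simp; ring
    rw [e2] at this
    linarith
  have hsum := (((hW.hasSum_one β).mul_left ((Real.log (a + b) - Real.log a) * a)).add
    ((hW.hasSum_one (β + 1)).mul_left ((Real.log (a + b) - Real.log b) * b))).sub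
    ((((hW.hasSum_one β).add (hW.hasSum_one (β + 1))).sub
      ((hW.hasSum_shift_sqrt β).mul_left 2)).mul_left (a * b / (a + b)))
  have hent := (summable_pairEntropy (fun y => mul_nonneg ha.le (hW.nonneg β y))
    (fun y => mul_nonneg hb.le (hW.nonneg (β + 1) y)) ((hW.hasSum_one β).mul_left a).summable
    ((hW.hasSum_one (β + 1)).mul_left b).summable).hasSum
  refine (hasSum_le h hent hsum).trans_eq ?_
  simp only [pairEntropy, Real.negMulLog]
  ring

/-- A second observation of the input decreases the conditional entropy by a definite amount. -/
lemma tsum_pairEntropy_two_le (hW : IsBinaryChannel W) (α β : ZMod 2) :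
    ∑' z : Y × Y, pairEntropy (1 / 2 * (W α z.1 * W β z.2))
      (1 / 2 * (W (α + 1) z.1 * W (β + 1) z.2)) ≤
      condEntropy W - 1 / 2 * (1 - bhattacharyya W) * bhattacharyya W ^ 2 := by
  have hs : ∀ γ δ : ZMod 2, Summable fun z : Y × Y => 1 / 2 * (W γ z.1 * W δ z.2) := fun γ δ =>
    ((hW.hasSum_one γ).summable.mul_of_nonneg (hW.hasSum_one δ).summable (hW.nonneg γ)
      (hW.nonneg δ)).mul_left _
  have hn : ∀ (γ δ : ZMod 2) (z : Y × Y), 0 ≤ 1 / 2 * (W γ z.1 * W δ z.2) := fun γ δ z =>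
    mul_nonneg (by norm_num) (mul_nonneg (hW.nonneg _ _) (hW.nonneg _ _))
  have hsum := summable_pairEntropy (hn α β) (hn (α + 1) (β + 1)) (hs _ _) (hs _ _)
  rw [hsum.tsum_prod]
  have e1 : ∀ y, pairEntropy (1 / 2 * W α y) (1 / 2 * W (α + 1) y) =
      pairEntropy (1 / 2 * W 0 y) (1 / 2 * W 1 y) := fun y => by
    fin_cases α
    · rfl
    · exact pairEntropy_comm _ _
  have e2 : ∀ y, 1 / 2 * W α y * (1 / 2 * W (α + 1) y) / (1 / 2 * W α y + 1 / 2 * W (α + 1) y) =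
      1 / 2 * W 0 y * (1 / 2 * W 1 y) / (1 / 2 * W 0 y + 1 / 2 * W 1 y) := fun y => by
    fin_cases α
    · rfl
    · change 1 / 2 * W 1 y * (1 / 2 * W 0 y) / (1 / 2 * W 1 y + 1 / 2 * W 0 y) = _
      rw [mul_comm, add_comm]
  -- Given the first output, its two masses serve as the prior for the second observation. Summing
  -- the drops gives `2 (1 - Z) ∑ a b / (a + b)`, which is at least `2 (1 - Z) Z ^ 2 / 4`.
  have hle := hasSum_le (fun y => ?_) hsum.prod.hasSum
    (hW.hasSum_condEntropy.sub (hW.summable_harmonic.hasSum.mul_left (2 * (1 - bhattacharyya W))))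
  · have := mul_le_mul_of_nonneg_left hW.sq_bhattacharyya_le
      (sub_nonneg.2 hW.bhattacharyya_le_one)
    linarith
  · have := hW.tsum_pairEntropy_mul_le (hW.half_nonneg α y) (hW.half_nonneg (α + 1) y) β
    rw [e1, e2] at this
    simpa only [mul_assoc] using this

end IsBinaryChannel

/-! ### Equivalent channels -/

section Equiv

variable {Y Y' : Type*} {V : ZMod 2 → Y → ℝ} {V' : ZMod 2 → Y' → ℝ}

lemma bhattacharyya_congr (e : Y ≃ Y') (h : ∀ x y, V' x (e y) = V x y) :
    bhattacharyya V = bhattacharyya V' := by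
  unfold bhattacharyya
  rw [← e.tsum_eq]
  simp [h]

lemma condEntropy_congr (e : Y ≃ Y') (h : ∀ x y, V' x (e y) = V x y) :
    condEntropy V = condEntropy V' := by
  unfold condEntropy
  rw [← e.tsum_eq]
  simp [h]

lemma IsBinaryChannel.congr (e : Y ≃ Y') (h : ∀ x y, V' x (e y) = V x y)
    (hV : IsBinaryChannel V') : IsBinaryChannel V := by
  refine ⟨fun x y => h x y ▸ hV.nonneg _ _, fun x => ?_⟩
  have := e.hasSum_iff.2 (hV.hasSum_one x)
  rwa [show V' x ∘ e = V x from funext fun y => h x y] at this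

end Equiv

/-! ### Vectors with a given prefix -/

section Prefix

variable {ι : Type*} [Fintype ι] [LinearOrder ι]

/-- The vectors `u` with `u i = x` and `u j = p j` for `j < i`. -/
def prefixFiber (i : ι) (x : ZMod 2) (p : {j : ι // j < i} → ZMod 2) : Finset (ι → ZMod 2) :=
  Finset.univ.filter fun u => u i = x ∧ ∀ j : {j : ι // j < i}, u j = p j

lemma mem_prefixFiber {i : ι} {x : ZMod 2} {p : {j : ι // j < i} → ZMod 2} {u : ι → ZMod 2} :
    u ∈ prefixFiber i x p ↔ u i = x ∧ ∀ j : {j : ι // j < i}, u j = p j := by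
  simp [prefixFiber]

lemma virtualChannel_apply {Y : Type*} (W : ZMod 2 → Y → ℝ) (G : Matrix ι ι (ZMod 2)) (i : ι)
    (x : ZMod 2) (z : (ι → Y) × ({j : ι // j < i} → ZMod 2)) :
    virtualChannel W G i x z =
      ∑ u ∈ prefixFiber i x z.2,
        (1 / 2 : ℝ) ^ (Fintype.card ι - 1) * ∏ j, W ((u ᵥ* G) j) (z.1 j) := rfl

lemma sum_sum_prefixFiber (i : ι) (x : ZMod 2) (f : (ι → ZMod 2) → ℝ) :
    ∑ p, ∑ u ∈ prefixFiber i x p, f u = ∑ u : ι → ZMod 2 with u i = x, f u := by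
  classical
  rw [← Finset.sum_fiberwise (Finset.univ.filter fun u : ι → ZMod 2 => u i = x)
    (fun u (j : {j : ι // j < i}) => u j) f]
  refine Finset.sum_congr rfl fun p _ => Finset.sum_congr ?_ fun _ _ => rfl
  ext u
  simp [mem_prefixFiber, funext_iff]

lemma card_filter_apply_eq (i : ι) (x : ZMod 2) :
    (Finset.univ.filter fun u : ι → ZMod 2 => u i = x).card = 2 ^ (Fintype.card ι - 1) := by
  classical
  have : (Finset.univ.filter fun u : ι → ZMod 2 => u i = x) =
      Fintype.piFinset fun j => if j = i then {x} else Finset.univ := by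
    ext u
    simp only [Finset.mem_filter, Finset.mem_univ, true_and, Fintype.mem_piFinset]
    constructor
    · intro h j
      split_ifs with hj
      · simp [hj, h]
      · simp
    · intro h
      simpa using h i
  rw [this, Fintype.card_piFinset, ← Finset.mul_prod_erase _ _ (Finset.mem_univ i)]
  rw [Finset.prod_congr rfl (g := fun _ => 2)]
  · simp
  · intro j hj
    simp [Finset.ne_of_mem_erase hj]

/-- For a fixed input bit, the weights of all prefixes and completions form a probability
distribution. -/
lemma sum_sum_prefixFiber_const (i : ι) (x : ZMod 2) (r : ℝ) :
    ∑ p, ∑ _u ∈ prefixFiber i x p, (1 / 2 : ℝ) ^ (Fintype.card ι - 1) * r = r := by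
  rw [sum_sum_prefixFiber, Finset.sum_const, card_filter_apply_eq, nsmul_eq_mul, ← mul_assoc]
  push_cast
  rw [← mul_pow]
  simp

/-- As `δ` vanishes before `i`, translation by `δ` keeps the prefix and flips bit `i`. Each such `δ`
thus pairs the completions of the two inputs. -/
lemma sum_prefixFiber_add {i : ι} {δ : ι → ZMod 2} (hi : δ i = 1) (hlt : ∀ j < i, δ j = 0)
    (x : ZMod 2) (p : {j : ι // j < i} → ZMod 2) (f : (ι → ZMod 2) → ℝ) :
    ∑ u ∈ prefixFiber i (x + 1) p, f u = ∑ u ∈ prefixFiber i x p, f (u + δ) := by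
  refine (Finset.sum_equiv (Equiv.addRight δ) (fun u => ?_) fun u _ => rfl).symm
  simp only [mem_prefixFiber, Equiv.coe_addRight, Pi.add_apply, hi, add_left_inj]
  refine and_congr_right fun _ => forall_congr' fun j => ?_
  rw [hlt j j.2, add_zero]

end Prefix

/-! ### One polarization step: validity of the virtual channels -/

section Kernel

variable {Y : Type*} {W : ZMod 2 → Y → ℝ} {n : ℕ}

lemma IsBinaryChannel.hasSum_pi (hW : IsBinaryChannel W) (x : Fin n → ZMod 2) :
    HasSum (fun y : Fin n → Y => ∏ j, W (x j) (y j)) 1 := by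
  simpa using hasSum_pi_prod (fun j => hW.nonneg (x j)) fun j => hW.hasSum_one (x j)

lemma IsBinaryChannel.prod_nonneg (hW : IsBinaryChannel W) {ι : Type*} [Fintype ι]
    (x : ι → ZMod 2) (y : ι → Y) : 0 ≤ ∏ j, W (x j) (y j) :=
  Finset.prod_nonneg fun _ _ => hW.nonneg _ _

lemma IsBinaryChannel.virtualChannel (hW : IsBinaryChannel W)
    (T : Matrix (Fin n) (Fin n) (ZMod 2)) (i : Fin n) :
    IsBinaryChannel (virtualChannel W T i) := by
  refine ⟨fun x z => ?_, fun x => ?_⟩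
  · rw [virtualChannel_apply]
    exact Finset.sum_nonneg fun u _ => mul_nonneg (by positivity) (hW.prod_nonneg _ _)
  · rw [← sum_sum_prefixFiber_const i x 1]
    refine hasSum_prod_of_fintype fun p => ?_
    simp only [virtualChannel_apply]
    exact hasSum_sum fun u _ => (hW.hasSum_pi (u ᵥ* T)).mul_left _

/-! ### One polarization step: the Bhattacharyya parameter -/

/-- The Bhattacharyya coefficient factorizes over the coordinates: a factor `Z(W)` where the two
words differ, a factor `1` where they agree. -/
lemma IsBinaryChannel.hasSum_sqrt_pi (hW : IsBinaryChannel W) (x x' : Fin n → ZMod 2) :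
    HasSum (fun y : Fin n → Y => √(∏ j, W (x j) (y j)) * √(∏ j, W (x' j) (y j)))
      (bhattacharyya W ^ hammingNorm (x' - x)) := by
  have h := hasSum_pi_prod (n := n) (f := fun j y => √(W (x j) y) * √(W (x' j) y))
    (a := fun j => if (x' - x) j ≠ 0 then bhattacharyya W else 1)
    (fun j y => mul_nonneg (Real.sqrt_nonneg _) (Real.sqrt_nonneg _)) fun j => by
      by_cases hj : x' j = x j
      · have h1 : ¬ (x' - x) j ≠ 0 := by simp [hj]
        rw [if_neg h1, hj]
        exact (hW.hasSum_one (x j)).congr_fun fun y => Real.mul_self_sqrt (hW.nonneg _ _)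
      · have h1 : (x' - x) j ≠ 0 := by simpa [sub_eq_zero] using hj
        rw [if_pos h1]
        have h2 : x' j = x j + 1 := by
          generalize x' j = s at hj
          generalize x j = t at hj
          revert s t; decide
        rw [h2]
        exact hW.hasSum_shift_sqrt (x j)
  rw [Finset.prod_ite, Finset.prod_const, Finset.prod_const_one, mul_one] at h
  refine h.congr_fun fun y => ?_
  rw [Real.sqrt_eq_rpow, Real.sqrt_eq_rpow, ← Real.finsetProd_rpow _ _ fun _ _ => hW.nonneg _ _,
    ← Real.finsetProd_rpow _ _ fun _ _ => hW.nonneg _ _, ← Finset.prod_mul_distrib]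
  simp [Real.sqrt_eq_rpow]

lemma mul_sqrt_mul_sqrt {c : ℝ} (hc : 0 ≤ c) (a b : ℝ) :
    c * (√a * √b) = √(c * a) * √(c * b) := by
  rw [Real.sqrt_mul hc, Real.sqrt_mul hc, mul_mul_mul_comm, Real.mul_self_sqrt hc]

/-- Pair the completions `u` and `u + δ`; all pairs of codewords differ by the same word `δ ᵥ* T`.
Cauchy–Schwarz bounds the sum of the paired roots by the root of the product of the sums. -/
lemma IsBinaryChannel.pow_le_bhattacharyya_virtualChannel (hW : IsBinaryChannel W)
    (T : Matrix (Fin n) (Fin n) (ZMod 2)) {i : Fin n} {δ : Fin n → ZMod 2} (hi : δ i = 1)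
    (hlt : ∀ j < i, δ j = 0) :
    bhattacharyya W ^ hammingNorm (δ ᵥ* T) ≤
      bhattacharyya (MultiKernelPolar.virtualChannel W T i) := by
  have h : HasSum (fun z : (Fin n → Y) × ({j : Fin n // j < i} → ZMod 2) =>
      ∑ u ∈ prefixFiber i 0 z.2, (1 / 2 : ℝ) ^ (Fintype.card (Fin n) - 1) *
        (√(∏ j, W ((u ᵥ* T) j) (z.1 j)) * √(∏ j, W (((u + δ) ᵥ* T) j) (z.1 j))))
      (bhattacharyya W ^ hammingNorm (δ ᵥ* T)) := by
    rw [← sum_sum_prefixFiber_const i 0 (bhattacharyya W ^ hammingNorm (δ ᵥ* T))]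
    refine hasSum_prod_of_fintype fun p => ?_
    dsimp only
    refine hasSum_sum fun u _ => HasSum.mul_left _ ?_
    have := hW.hasSum_sqrt_pi (u ᵥ* T) ((u + δ) ᵥ* T)
    rwa [show (u + δ) ᵥ* T - u ᵥ* T = δ ᵥ* T by
      rw [Matrix.add_vecMul, add_sub_cancel_left]] at this
  refine hasSum_le (fun z => ?_) h (hW.virtualChannel T i).hasSum_bhattacharyya
  have hn := hW.prod_nonneg (ι := Fin n)
  rw [Real.sqrt_mul ((hW.virtualChannel T i).nonneg _ _), virtualChannel_apply,
    virtualChannel_apply, show (1 : ZMod 2) = 0 + 1 from rfl, sum_prefixFiber_add hi hlt,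
    mul_comm]
  refine le_trans (le_of_eq ?_) (Real.sum_sqrt_mul_sqrt_le (prefixFiber i 0 z.2)
    (fun u => mul_nonneg (by positivity) (hn (u ᵥ* T) z.1))
    (fun u => mul_nonneg (by positivity) (hn ((u + δ) ᵥ* T) z.1)))
  refine Finset.sum_congr rfl fun u _ => ?_
  exact mul_sqrt_mul_sqrt (by positivity) _ _

lemma sqrt_sum_le {α : Type*} (s : Finset α) {f : α → ℝ} (hf : ∀ a, 0 ≤ f a) :
    √(∑ a ∈ s, f a) ≤ ∑ a ∈ s, √(f a) := by
  classical
  induction s using Finset.induction_on with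
  | empty => simp
  | insert a s ha ih =>
    rw [Finset.sum_insert ha, Finset.sum_insert ha]
    refine le_trans ?_ (add_le_add_right ih _)
    have hs : 0 ≤ ∑ a ∈ s, f a := Finset.sum_nonneg fun _ _ => hf _
    rw [Real.sqrt_le_left (by positivity)]
    nlinarith [Real.sq_sqrt (hf a), Real.sq_sqrt hs,
      mul_nonneg (Real.sqrt_nonneg (f a)) (Real.sqrt_nonneg (∑ a ∈ s, f a))]

/-- A union bound: subadditivity of the root leaves a sum over all pairs of completions, each pair
at codeword distance at least `D`. The crude count `2 ^ n` is enough, since a constant factor does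
not affect the exponent. -/
lemma IsBinaryChannel.bhattacharyya_virtualChannel_le (hW : IsBinaryChannel W)
    (T : Matrix (Fin n) (Fin n) (ZMod 2)) {i : Fin n} {D : ℕ}
    (hD : ∀ δ : Fin n → ZMod 2, δ i = 1 → (∀ j < i, δ j = 0) → D ≤ hammingNorm (δ ᵥ* T)) :
    bhattacharyya (MultiKernelPolar.virtualChannel W T i) ≤ 2 ^ n * bhattacharyya W ^ D := by
  have h : HasSum (fun z : (Fin n → Y) × ({j : Fin n // j < i} → ZMod 2) =>
      ∑ u ∈ prefixFiber i 0 z.2, ∑ v ∈ prefixFiber i 1 z.2,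
        (1 / 2 : ℝ) ^ (Fintype.card (Fin n) - 1) *
        (√(∏ j, W ((u ᵥ* T) j) (z.1 j)) * √(∏ j, W ((v ᵥ* T) j) (z.1 j))))
      (∑ p, ∑ u ∈ prefixFiber i 0 p, ∑ v ∈ prefixFiber i 1 p,
        (1 / 2 : ℝ) ^ (Fintype.card (Fin n) - 1) *
          bhattacharyya W ^ hammingNorm (v ᵥ* T - u ᵥ* T)) := by
    refine hasSum_prod_of_fintype fun p => ?_
    dsimp only
    exact hasSum_sum fun u _ => hasSum_sum fun v _ =>
      HasSum.mul_left _ (hW.hasSum_sqrt_pi (u ᵥ* T) (v ᵥ* T))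
  have hn := hW.prod_nonneg (ι := Fin n)
  have hZ0 := IsBinaryChannel.bhattacharyya_nonneg W
  refine (hasSum_le (fun z => ?_) (hW.virtualChannel T i).hasSum_bhattacharyya h).trans ?_
  · rw [Real.sqrt_mul ((hW.virtualChannel T i).nonneg _ _), virtualChannel_apply,
      virtualChannel_apply, mul_comm]
    refine (mul_le_mul (sqrt_sum_le _ fun u => mul_nonneg (by positivity) (hn _ _))
      (sqrt_sum_le _ fun u => mul_nonneg (by positivity) (hn _ _)) (Real.sqrt_nonneg _)
      (Finset.sum_nonneg fun _ _ => Real.sqrt_nonneg _)).trans (le_of_eq ?_)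
    rw [Finset.sum_mul_sum]
    refine Finset.sum_congr rfl fun u _ => Finset.sum_congr rfl fun v _ => ?_
    exact (mul_sqrt_mul_sqrt (by positivity) _ _).symm
  · have hle : ∀ p, ∑ u ∈ prefixFiber i 0 p, ∑ v ∈ prefixFiber i 1 p,
        (1 / 2 : ℝ) ^ (Fintype.card (Fin n) - 1) *
          bhattacharyya W ^ hammingNorm (v ᵥ* T - u ᵥ* T) ≤
        ∑ u ∈ prefixFiber i 0 p, (1 / 2 : ℝ) ^ (Fintype.card (Fin n) - 1) *
          (2 ^ n * bhattacharyya W ^ D) := by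
      intro p
      refine Finset.sum_le_sum fun u hu => ?_
      rw [← Finset.mul_sum]
      refine mul_le_mul_of_nonneg_left ?_ (by positivity)
      refine (Finset.sum_le_card_nsmul _ _ (bhattacharyya W ^ D) fun v hv => ?_).trans ?_
      · rw [← Matrix.sub_vecMul]
        refine pow_le_pow_of_le_one hZ0 hW.bhattacharyya_le_one (hD _ ?_ fun j hj => ?_)
        · simp [(mem_prefixFiber.1 hu).1, (mem_prefixFiber.1 hv).1]
        · have h1 := (mem_prefixFiber.1 hu).2 ⟨j, hj⟩
          have h2 := (mem_prefixFiber.1 hv).2 ⟨j, hj⟩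
          simp only at h1 h2
          simp [h1, h2]
      · rw [nsmul_eq_mul]
        refine mul_le_mul_of_nonneg_right ?_ (by positivity)
        have := Finset.card_le_univ (prefixFiber i 1 p)
        rw [Fintype.card_fun, Fintype.card_fin, ZMod.card] at this
        exact_mod_cast this
    exact (Finset.sum_le_sum fun p _ => hle p).trans_eq (sum_sum_prefixFiber_const i 0 _)

end Kernel

/-! ### The chain rule for the entropy -/

/-- The Leibniz rule for `negMulLog`, written with full products so that a sum over vectors factors
coordinate by coordinate. -/
lemma negMulLog_prod {n : ℕ} (a : Fin n → ℝ) :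
    Real.negMulLog (∏ j, a j) = ∑ j, ∏ k, if k = j then Real.negMulLog (a k) else a k := by
  induction n with
  | zero => simp
  | succ n ih =>
    rw [Fin.prod_univ_succ, Real.negMulLog_mul, ih, Fin.sum_univ_succ, Finset.mul_sum]
    congr 1
    · simp [Fin.prod_univ_succ, Fin.succ_ne_zero, mul_comm]
    · refine Finset.sum_congr rfl fun j _ => ?_
      simp [Fin.prod_univ_succ, (Fin.succ_ne_zero j).symm]

/-- The entropy of a vector of masses indexed by binary vectors is the sum of the conditional
entropies of the coordinates given the preceding ones. -/
lemma sum_pairEntropy_prefixFiber {n : ℕ} (v : (Fin n → ZMod 2) → ℝ) :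
    ∑ i : Fin n, ∑ p : {j : Fin n // j < i} → ZMod 2,
      pairEntropy (∑ u ∈ prefixFiber i 0 p, v u) (∑ u ∈ prefixFiber i 1 p, v u) =
    ∑ u, Real.negMulLog (v u) - Real.negMulLog (∑ u, v u) := by
  classical
  -- `S k` is the entropy of the first `k` coordinates; the conditional entropies are its
  -- increments, so the sum telescopes.
  let S : ℕ → ℝ := fun k => ∑ p : {j : Fin n // j.val < k} → ZMod 2,
    Real.negMulLog (∑ u : Fin n → ZMod 2 with ∀ j : {j : Fin n // j.val < k}, u j = p j, v u)
  have h0 : S 0 = Real.negMulLog (∑ u, v u) := by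
    have : IsEmpty {j : Fin n // j.val < 0} := ⟨fun j => absurd j.2 (by simp)⟩
    simp [S]
  have hn : S n = ∑ u, Real.negMulLog (v u) := by
    let e : (Fin n → ZMod 2) ≃ ({j : Fin n // j.val < n} → ZMod 2) :=
      { toFun := fun u j => u j
        invFun := fun p j => p ⟨j, j.2⟩
        left_inv := fun u => rfl
        right_inv := fun p => rfl }
    refine Fintype.sum_equiv e.symm _ _ fun p => ?_
    rw [Finset.sum_eq_single (e.symm p)]
    · intro u hu hne
      refine absurd (funext fun j => ?_) hne
      exact (Finset.mem_filter.1 hu).2 ⟨j, j.2⟩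
    · intro h
      exact absurd (Finset.mem_filter.2 ⟨Finset.mem_univ _, fun j => rfl⟩) h
  have hstep : ∀ i : Fin n, S (i + 1) - S i = ∑ p : {j : Fin n // j < i} → ZMod 2,
      pairEntropy (∑ u ∈ prefixFiber i 0 p, v u) (∑ u ∈ prefixFiber i 1 p, v u) := by
    intro i
    let E : ({j : Fin n // j.val < i.val + 1} → ZMod 2) ≃ ({j : Fin n // j < i} → ZMod 2) × ZMod 2 :=
      { toFun := fun q => (fun j => q ⟨j, Nat.lt_succ_of_lt j.2⟩, q ⟨i, Nat.lt_succ_self _⟩)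
        invFun := fun z j => if h : j.1 < i then z.1 ⟨j.1, h⟩ else z.2
        left_inv := fun q => by
          funext j
          by_cases h : j.1 < i
          · simp [h]
          · have : j = ⟨i, Nat.lt_succ_self _⟩ :=
              Subtype.ext (le_antisymm (Nat.le_of_lt_succ j.2) (not_lt.1 h))
            subst this
            simp
        right_inv := fun z => by
          ext j
          · simp [j.2]
          · simp }
    have h1 : S (i + 1) = ∑ p : {j : Fin n // j < i} → ZMod 2, ∑ x : ZMod 2,
        Real.negMulLog (∑ u ∈ prefixFiber i x p, v u) := by
      rw [← Fintype.sum_prod_type']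
      refine Fintype.sum_equiv E _ _ fun q => ?_
      congr 2
      ext u
      simp only [Finset.mem_filter, Finset.mem_univ, true_and, mem_prefixFiber]
      constructor
      · intro h
        exact ⟨h ⟨i, Nat.lt_succ_self _⟩, fun j => h ⟨j, Nat.lt_succ_of_lt j.2⟩⟩
      · rintro ⟨h, h'⟩ ⟨j, hj⟩
        rcases (Nat.le_of_lt_succ hj).lt_or_eq with hlt | heq
        · exact h' ⟨j, hlt⟩
        · obtain rfl : j = i := Fin.ext heq
          exact h
    have h2 : S i = ∑ p : {j : Fin n // j < i} → ZMod 2,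
        Real.negMulLog (∑ u ∈ prefixFiber i 0 p, v u + ∑ u ∈ prefixFiber i 1 p, v u) := by
      refine Fintype.sum_equiv (Equiv.refl ({j : Fin n // j < i} → ZMod 2)) _ _ fun p => ?_
      congr 1
      rw [← Finset.sum_union]
      · refine Finset.sum_congr ?_ fun _ _ => rfl
        ext u
        have : u i = 0 ∨ u i = 1 := by generalize u i = t; revert t; decide
        simp only [Finset.mem_filter, Finset.mem_univ, true_and, Finset.mem_union,
          mem_prefixFiber, ← or_and_right, this]
        rfl
      · rw [Finset.disjoint_left]
        intro u h h'
        have := (mem_prefixFiber.1 h).1.symm.trans (mem_prefixFiber.1 h').1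
        exact zero_ne_one this
    rw [h1, h2, ← Finset.sum_sub_distrib]
    refine Finset.sum_congr rfl fun p _ => ?_
    rw [show (Finset.univ : Finset (ZMod 2)) = {0, 1} from rfl, Finset.sum_pair zero_ne_one]
    rfl
  rw [← h0, ← hn, ← Finset.sum_range_sub S n, ← Fin.sum_univ_eq_sum_range (fun k => S (k + 1) - S k)]
  exact Finset.sum_congr rfl fun i _ => (hstep i).symm

section Kernel

variable {Y : Type*} {W : ZMod 2 → Y → ℝ} {n : ℕ}

/-- Independent uses of the channel have additive conditional entropy. By the Leibniz rule the
summand is a sum over `j` of products with an entropy at `j` and output masses elsewhere. -/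
lemma IsBinaryChannel.hasSum_entropy_pi (hW : IsBinaryChannel W) :
    HasSum (fun y : Fin n → Y =>
      ∑ x : Fin n → ZMod 2, Real.negMulLog (∏ j, 1 / 2 * W (x j) (y j)) -
        Real.negMulLog (∑ x : Fin n → ZMod 2, ∏ j, 1 / 2 * W (x j) (y j)))
      (n * condEntropy W) := by
  have h : ∀ j : Fin n, HasSum (fun y : Fin n → Y => ∏ k, if k = j then
      pairEntropy (1 / 2 * W 0 (y k)) (1 / 2 * W 1 (y k)) else
        1 / 2 * W 0 (y k) + 1 / 2 * W 1 (y k)) (condEntropy W) := by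
    intro j
    have := hasSum_pi_prod (n := n) (f := fun k y => if k = j then
      pairEntropy (1 / 2 * W 0 y) (1 / 2 * W 1 y) else 1 / 2 * W 0 y + 1 / 2 * W 1 y)
      (a := fun k => if k = j then condEntropy W else 1) ?_ ?_
    · simpa using this
    · intro k y
      split_ifs
      · exact pairEntropy_nonneg (hW.half_nonneg 0 y) (hW.half_nonneg 1 y)
      · exact add_nonneg (hW.half_nonneg 0 y) (hW.half_nonneg 1 y)
    · intro k
      split_ifs
      · exact hW.hasSum_condEntropy
      · exact hW.hasSum_half_add
  have hs := hasSum_sum fun j (_ : j ∈ Finset.univ) => h j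
  rw [Finset.sum_const, Finset.card_univ, Fintype.card_fin, nsmul_eq_mul] at hs
  refine hs.congr_fun fun y => ?_
  have e1 : ∀ g : Fin n → ZMod 2 → ℝ, ∑ x : Fin n → ZMod 2, ∏ j, g j (x j) =
      ∏ j, (g j 0 + g j 1) := by
    intro g
    rw [← Fintype.piFinset_univ, ← Finset.prod_univ_sum]
    refine Finset.prod_congr rfl fun j _ => ?_
    rw [show (Finset.univ : Finset (ZMod 2)) = {0, 1} from rfl, Finset.sum_pair zero_ne_one]
  rw [e1 fun j t => 1 / 2 * W t (y j)]
  simp only [negMulLog_prod]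
  rw [Finset.sum_comm, ← Finset.sum_sub_distrib]
  refine Finset.sum_congr rfl fun j _ => ?_
  rw [e1 fun k t => if k = j then Real.negMulLog (1 / 2 * W t (y k)) else 1 / 2 * W t (y k)]
  rw [← Finset.mul_prod_erase _ _ (Finset.mem_univ j),
    ← Finset.mul_prod_erase _ _ (Finset.mem_univ j),
    ← Finset.mul_prod_erase Finset.univ (fun k => if k = j then
      pairEntropy (1 / 2 * W 0 (y k)) (1 / 2 * W 1 (y k)) else
        1 / 2 * W 0 (y k) + 1 / 2 * W 1 (y k)) (Finset.mem_univ j)]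
  have e2 : ∀ f g : Fin n → ℝ, ∏ k ∈ Finset.univ.erase j, (if k = j then f k else g k) =
      ∏ k ∈ Finset.univ.erase j, g k := fun f g =>
    Finset.prod_congr rfl fun k hk => if_neg (Finset.ne_of_mem_erase hk)
  have e3 : ∏ k ∈ Finset.univ.erase j,
      ((if k = j then Real.negMulLog (1 / 2 * W 0 (y k)) else 1 / 2 * W 0 (y k)) +
        (if k = j then Real.negMulLog (1 / 2 * W 1 (y k)) else 1 / 2 * W 1 (y k))) =
      ∏ k ∈ Finset.univ.erase j, (1 / 2 * W 0 (y k) + 1 / 2 * W 1 (y k)) :=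
    Finset.prod_congr rfl fun k hk => by simp [Finset.ne_of_mem_erase hk]
  rw [e2, e2, e3]
  simp only [if_true, pairEntropy]
  ring

/-- The prior `1 / 2` of the input bit completes the `n - 1` factors in the normalization, giving
one factor for each channel use. -/
lemma half_mul_virtualChannel (T : Matrix (Fin n) (Fin n) (ZMod 2)) (i : Fin n) (x : ZMod 2)
    (z : (Fin n → Y) × ({j : Fin n // j < i} → ZMod 2)) :
    1 / 2 * virtualChannel W T i x z =
      ∑ u ∈ prefixFiber i x z.2, ∏ j, 1 / 2 * W ((u ᵥ* T) j) (z.1 j) := by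
  rw [virtualChannel_apply, Finset.mul_sum]
  refine Finset.sum_congr rfl fun u _ => ?_
  have : n - 1 + 1 = n := Nat.succ_pred_eq_of_pos i.pos
  rw [Finset.prod_mul_distrib, Finset.prod_const, Finset.card_univ, Fintype.card_fin, ← mul_assoc,
    ← pow_succ', this]

/-- The chain rule turns the left side into the entropy of `u` given the outputs. Since `u ↦ u ᵥ* T`
is bijective, this is the entropy of `n` independent channel inputs. -/
lemma IsBinaryChannel.sum_condEntropy_virtualChannel (hW : IsBinaryChannel W)
    {T : Matrix (Fin n) (Fin n) (ZMod 2)} (hT : IsUnit T) :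
    ∑ i, condEntropy (MultiKernelPolar.virtualChannel W T i) = n * condEntropy W := by
  have h := hasSum_sum fun i (_ : i ∈ Finset.univ) =>
    hasSum_sum_of_prod (hW.virtualChannel T i).hasSum_condEntropy
  refine h.unique (hW.hasSum_entropy_pi.congr_fun fun y => ?_)
  simp only [half_mul_virtualChannel]
  rw [sum_pairEntropy_prefixFiber fun u => ∏ j, 1 / 2 * W ((u ᵥ* T) j) (y j)]
  have hb : Function.Bijective fun u : Fin n → ZMod 2 => u ᵥ* T :=
    (Finite.injective_iff_bijective).1 (Matrix.vecMul_injective_iff_isUnit.2 hT)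
  rw [hb.sum_comp fun x => Real.negMulLog (∏ j, 1 / 2 * W (x j) (y j)),
    hb.sum_comp fun x => ∏ j, 1 / 2 * W (x j) (y j)]

end Kernel

/-! ### Partial distances -/

section PartialDistance

variable {n : ℕ} {T : Matrix (Fin n) (Fin n) (ZMod 2)}

lemma mem_span_rows_Ioi_iff {i : Fin n} {c : Fin n → ZMod 2} :
    c ∈ Submodule.span (ZMod 2) (T.row '' Set.Ioi i) ↔
      ∃ δ : Fin n → ZMod 2, (∀ j ≤ i, δ j = 0) ∧ δ ᵥ* T = c := by
  constructor
  · intro h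
    induction h using Submodule.span_induction with
    | mem c hc =>
      obtain ⟨k, hk, rfl⟩ := hc
      refine ⟨Pi.single k 1, fun j hj => Pi.single_eq_of_ne (hj.trans_lt hk).ne _, ?_⟩
      rw [Matrix.single_one_vecMul]
    | zero => exact ⟨0, fun _ _ => rfl, Matrix.zero_vecMul _⟩
    | add c d _ _ hc hd =>
      obtain ⟨δ, h, rfl⟩ := hc
      obtain ⟨ε, h', rfl⟩ := hd
      exact ⟨δ + ε, fun j hj => by simp [h j hj, h' j hj], Matrix.add_vecMul _ _ _⟩
    | smul a c _ hc =>
      obtain ⟨δ, h, rfl⟩ := hc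
      exact ⟨a • δ, fun j hj => by simp [h j hj], Matrix.smul_vecMul _ _ _⟩
  · rintro ⟨δ, h, rfl⟩
    rw [Matrix.vecMul_eq_sum]
    refine Submodule.sum_mem _ fun j _ => ?_
    rcases le_or_gt j i with hj | hj
    · rw [h j hj, zero_smul]; exact Submodule.zero_mem _
    · exact Submodule.smul_mem _ _ (Submodule.subset_span ⟨j, hj, rfl⟩)

lemma hammingDist_eq_hammingNorm_add (x y : Fin n → ZMod 2) :
    hammingDist x y = hammingNorm (x + y) := by
  rw [hammingDist_eq_hammingNorm, show -x = x from funext fun j => CharTwo.neg_eq (x j)]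

/-- Over `𝔽₂` the distance from row `i` to the span below is the least weight of `δ ᵥ* T` with `δ`
having its first nonzero entry at `i`. This and `partialDistance_le_hammingNorm` translate partial
distances into differences of completions. -/
lemma exists_hammingNorm_eq_partialDistance (T : Matrix (Fin n) (Fin n) (ZMod 2)) (i : Fin n) :
    ∃ δ : Fin n → ZMod 2, δ i = 1 ∧ (∀ j < i, δ j = 0) ∧
      hammingNorm (δ ᵥ* T) = partialDistance T i := by
  have hne : ((fun c => hammingDist (T.row i) c) ''
      (Submodule.span (ZMod 2) (T.row '' Set.Ioi i) : Set (Fin n → ZMod 2))).Nonempty :=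
    ⟨_, 0, Submodule.zero_mem _, rfl⟩
  obtain ⟨c, hc, h⟩ := Nat.sInf_mem hne
  obtain ⟨δ, hδ, rfl⟩ := mem_span_rows_Ioi_iff.1 hc
  refine ⟨Pi.single i 1 + δ, by simp [hδ i le_rfl], fun j hj => ?_, ?_⟩
  · simp [hδ j hj.le, hj.ne]
  · rw [partialDistance, ← h, Matrix.add_vecMul, Matrix.single_one_vecMul]
    exact (hammingDist_eq_hammingNorm_add _ _).symm

lemma partialDistance_le_hammingNorm {i : Fin n} {δ : Fin n → ZMod 2} (hi : δ i = 1)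
    (hlt : ∀ j < i, δ j = 0) : partialDistance T i ≤ hammingNorm (δ ᵥ* T) := by
  refine Nat.sInf_le ⟨(δ - Pi.single i 1) ᵥ* T, mem_span_rows_Ioi_iff.2 ⟨_, fun j hj => ?_, rfl⟩, ?_⟩
  · rcases hj.lt_or_eq with hj | rfl
    · simp [hlt j hj, hj.ne]
    · simp [hi]
  · dsimp only
    rw [hammingDist_eq_hammingNorm_add, Matrix.sub_vecMul, Matrix.single_one_vecMul]
    congr 1
    exact add_sub_cancel _ _

lemma one_le_partialDistance (hT : IsUnit T) (i : Fin n) : 1 ≤ partialDistance T i := by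
  obtain ⟨δ, hi, -, h⟩ := exists_hammingNorm_eq_partialDistance T i
  rw [← h, Nat.one_le_iff_ne_zero, ne_eq, hammingNorm_eq_zero]
  intro h0
  have : δ = 0 := Matrix.vecMul_injective_iff_isUnit.2 hT (h0.trans (Matrix.zero_vecMul T).symm)
  simp [this] at hi

lemma exists_hammingNorm_one_eq_single {v : Fin n → ZMod 2} (hv : hammingNorm v = 1) :
    ∃ q, v = Pi.single q 1 := by
  obtain ⟨q, hq⟩ := Finset.card_eq_one.1 hv
  refine ⟨q, funext fun j => ?_⟩
  have hj : v j ≠ 0 ↔ j = q := by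
    have := congrArg (j ∈ ·) hq
    simpa using this
  by_cases h : j = q
  · subst h
    rw [Pi.single_eq_same]
    have := hj.2 rfl
    generalize v j = t at this
    revert t; decide
  · rw [Pi.single_eq_of_ne h]
    exact not_not.1 fun h' => h (hj.1 h')

/-- If all rows from the `k`-th on have partial distance one, they span a coordinate subspace. -/
lemma exists_coordinate_subspace (k : ℕ) (hk : k ≤ n)
    (hD : ∀ i : Fin n, k ≤ i → partialDistance T i = 1) :
    ∃ S : Set (Fin n), ∀ v : Fin n → ZMod 2,
      (∃ δ : Fin n → ZMod 2, (∀ j : Fin n, j.val < k → δ j = 0) ∧ δ ᵥ* T = v) ↔ ∀ j ∉ S, v j = 0 := by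
  induction hk using Nat.decreasingInduction with
  | self =>
    refine ⟨∅, fun v => ⟨?_, fun h => ⟨0, fun _ _ => rfl, ?_⟩⟩⟩
    · rintro ⟨δ, h, rfl⟩ j _
      have : δ = 0 := funext fun j => h j j.2
      simp [this]
    · rw [Matrix.zero_vecMul]
      exact (funext fun j => h j (Set.notMem_empty j)).symm
  | of_succ k hkn ih =>
    obtain ⟨S, hS⟩ := ih fun i hi => hD i (Nat.le_of_succ_le hi)
    -- Distance one means that some combination starting at row `k` is a unit vector at a column
    -- `q`. Modulo it, combinations from row `k` on reduce to those from row `k + 1` on, so `q` is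
    -- adjoined to `S`.
    obtain ⟨δ₀, h1, h2, h3⟩ := exists_hammingNorm_eq_partialDistance T ⟨k, hkn⟩
    rw [hD _ le_rfl] at h3
    obtain ⟨q, hq⟩ := exists_hammingNorm_one_eq_single h3
    refine ⟨insert q S, fun v => ⟨?_, fun h => ?_⟩⟩
    · rintro ⟨δ, hδ, rfl⟩ j hj
      have hjq : j ≠ q := fun h => hj (h ▸ Set.mem_insert _ _)
      have hjS : j ∉ S := fun h => hj (Set.mem_insert_of_mem _ h)
      have := (hS ((δ - δ ⟨k, hkn⟩ • δ₀) ᵥ* T)).1 ⟨_, fun j hj => ?_, rfl⟩ j hjS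
      · rw [Matrix.sub_vecMul, Matrix.smul_vecMul, hq] at this
        simpa [hjq] using this
      · rcases (Nat.le_of_lt_succ hj).lt_or_eq with hlt | heq
        · have h2' := h2 j hlt
          simp [hδ j hlt, h2']
        · obtain rfl : j = ⟨k, hkn⟩ := Fin.ext heq
          simp [h1]
    · obtain ⟨δ, hδ, h'⟩ := (hS (v - v q • δ₀ ᵥ* T)).2 fun j hj => by
        by_cases hjq : j = q
        · subst hjq; simp [hq]
        · simp [hq, hjq, h j (by simp [hjq, hj])]
      refine ⟨δ + v q • δ₀, fun j hj => ?_, ?_⟩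
      · have h2' := h2 j hj
        simp [hδ j (Nat.lt_succ_of_lt hj), h2']
      · rw [Matrix.add_vecMul, Matrix.smul_vecMul, h', sub_add_cancel]

/-- If some partial distance exceeds one, there are a row and two columns in which that row is
one and in which the span of the rows below it vanishes. -/
lemma exists_two_columns (h : ∃ i, 2 ≤ partialDistance T i) (hT : IsUnit T) :
    ∃ i a b, a ≠ b ∧ T i a = 1 ∧ T i b = 1 ∧
      ∀ δ : Fin n → ZMod 2, (∀ j ≤ i, δ j = 0) → (δ ᵥ* T) a = 0 ∧ (δ ᵥ* T) b = 0 := by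
  classical
  -- Take the last such row: all rows below have partial distance one, so they span a coordinate
  -- subspace.
  obtain ⟨i, hi, hmax⟩ := (Finset.univ.filter fun i => 2 ≤ partialDistance T i).exists_max_image id
    (h.imp fun i hi => by simpa using hi)
  simp only [Finset.mem_filter, Finset.mem_univ, true_and, id] at hi hmax
  obtain ⟨S, hS⟩ := exists_coordinate_subspace (T := T) (i + 1) i.2 fun j hj => by
    refine le_antisymm ?_ (one_le_partialDistance hT j)
    by_contra hlt
    exact absurd (hmax j (by omega)) (not_le.2 hj)
  -- The part of row `i` supported on `S` lies in the span below. Removing it leaves a word of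
  -- weight at least `D_i ≥ 2` supported off `S`, where all lower rows vanish.
  obtain ⟨δ, hδ, hδS⟩ := (hS (S.indicator (T i))).2 fun j hj => Set.indicator_of_notMem hj _
  have hle : 2 ≤ hammingNorm ((Pi.single i 1 - δ) ᵥ* T) := by
    refine hi.trans (partialDistance_le_hammingNorm ?_ fun j hj => ?_)
    · simp [hδ i (Nat.lt_succ_self _)]
    · simp [hδ j (Nat.lt_succ_of_lt hj), hj.ne]
  rw [Matrix.sub_vecMul, Matrix.single_one_vecMul, hδS] at hle
  obtain ⟨a, ha, b, hb, hab⟩ := Finset.one_lt_card.1 hle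
  have key : ∀ c, (T.row i - S.indicator (T i)) c ≠ 0 → c ∉ S ∧ T i c = 1 := by
    intro c hc
    have hcS : c ∉ S := fun h => hc (by simp [Set.indicator_of_mem h])
    refine ⟨hcS, ?_⟩
    rw [Pi.sub_apply, Set.indicator_of_notMem hcS, sub_zero, Matrix.row_apply] at hc
    generalize T i c = t at hc
    revert t; decide
  obtain ⟨haS, ha1⟩ := key a (Finset.mem_filter.1 ha).2
  obtain ⟨hbS, hb1⟩ := key b (Finset.mem_filter.1 hb).2
  refine ⟨i, a, b, hab, ha1, hb1, fun ε hε => ?_⟩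
  have := (hS (ε ᵥ* T)).1 ⟨ε, fun j hj => hε j (Nat.le_of_lt_succ hj), rfl⟩
  exact ⟨this a haS, this b hbS⟩

end PartialDistance

/-! ### One polarization step: a definite increase of the mutual information -/

section Kernel

variable {Y : Type*} {W : ZMod 2 → Y → ℝ} {n : ℕ}

lemma IsBinaryChannel.hasSum_pi_marginal (hW : IsBinaryChannel W) (x : Fin n → ZMod 2)
    {a b : Fin n} (hab : a ≠ b) (z : Y × Y) :
    HasSum (fun y : Fin n → Y => {y : Fin n → Y | (y a, y b) = z}.indicator
      (fun y => ∏ j, W (x j) (y j)) y) (W (x a) z.1 * W (x b) z.2) := by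
  classical
  obtain ⟨s, t⟩ := z
  -- The constraints on coordinates `a` and `b` are moved into their factors, so that the restricted
  -- sum is again a product.
  have h := hasSum_pi_prod (n := n)
    (f := fun j y => if (j = a ∧ y ≠ s) ∨ (j = b ∧ y ≠ t) then 0 else W (x j) y)
    (a := fun j => (if j = a then W (x a) s else 1) * (if j = b then W (x b) t else 1)) ?_ ?_
  · rw [Finset.prod_mul_distrib, Finset.prod_ite_eq' Finset.univ a, Finset.prod_ite_eq' Finset.univ b,
      if_pos (Finset.mem_univ _), if_pos (Finset.mem_univ _)] at h
    refine h.congr_fun fun y => ?_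
    by_cases hy : (y a, y b) = (s, t)
    · rw [Set.indicator_of_mem (show y ∈ {y : Fin n → Y | (y a, y b) = (s, t)} from hy)]
      rw [Prod.mk.injEq] at hy
      refine Finset.prod_congr rfl fun j _ => (if_neg ?_).symm
      rintro (⟨rfl, h'⟩ | ⟨rfl, h'⟩)
      · exact h' hy.1
      · exact h' hy.2
    · rw [Set.indicator_of_notMem (show y ∉ {y : Fin n → Y | (y a, y b) = (s, t)} from hy)]
      rw [Prod.mk.injEq, not_and_or] at hy
      rcases hy with hy | hy
      · refine (Finset.prod_eq_zero (Finset.mem_univ a) ?_).symm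
        exact if_pos (Or.inl ⟨rfl, hy⟩)
      · refine (Finset.prod_eq_zero (Finset.mem_univ b) ?_).symm
        exact if_pos (Or.inr ⟨rfl, hy⟩)
  · intro j y
    split_ifs
    · exact le_rfl
    · exact hW.nonneg _ _
  · intro j
    by_cases hja : j = a
    · subst hja
      have hsum := hasSum_ite_eq s (W (x j) s)
      simp only [if_true, if_neg hab, mul_one]
      refine hsum.congr_fun fun y => ?_
      by_cases hy : y = s
      · simp [hy, hab]
      · simp [hy]
    · by_cases hjb : j = b
      · subst hjb
        have hsum := hasSum_ite_eq t (W (x j) t)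
        simp only [if_true, if_neg hja, one_mul]
        refine hsum.congr_fun fun y => ?_
        by_cases hy : y = t
        · simp [hy, hja]
        · simp [hy]
      · simpa [hja, hjb] using hW.hasSum_one (x j)

/-- Forget all outputs except those at `a` and `b`; the entropy can only grow. Given the past bits,
the inputs there are known shifts of `u_i`, because later bits do not reach these columns. What is
left is two observations of one bit. -/
lemma IsBinaryChannel.condEntropy_virtualChannel_le_of_columns (hW : IsBinaryChannel W)
    {T : Matrix (Fin n) (Fin n) (ZMod 2)} {i a b : Fin n} (hab : a ≠ b) (ha : T i a = 1)
    (hb : T i b = 1) (hδ : ∀ δ : Fin n → ZMod 2, (∀ j ≤ i, δ j = 0) →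
      (δ ᵥ* T) a = 0 ∧ (δ ᵥ* T) b = 0) :
    condEntropy (MultiKernelPolar.virtualChannel W T i) ≤
      condEntropy W - 1 / 2 * (1 - bhattacharyya W) * bhattacharyya W ^ 2 := by
  classical
  have hV := hW.virtualChannel T i
  let c : ℝ := (1 / 2 : ℝ) ^ (Fintype.card (Fin n) - 1)
  let g := 1 / 2 * (1 - bhattacharyya W) * bhattacharyya W ^ 2
  have hc : 0 ≤ c := by positivity
  -- The past padded by zeros; its image gives the known shifts at the two columns.
  let u₀ : ({j : Fin n // j < i} → ZMod 2) → Fin n → ZMod 2 := fun p j =>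
    if h : j < i then p ⟨j, h⟩ else 0
  have hu : ∀ x p, ∀ u ∈ prefixFiber i x p, (u ᵥ* T) a = (u₀ p ᵥ* T) a + x ∧
      (u ᵥ* T) b = (u₀ p ᵥ* T) b + x := by
    intro x p u hu
    have e : u = (u - u₀ p - Pi.single i x) + u₀ p + Pi.single i x := by abel
    have h0 := hδ (u - u₀ p - Pi.single i x) fun j hj => by
      rcases hj.lt_or_eq with hlt | rfl
      · have := (mem_prefixFiber.1 hu).2 ⟨j, hlt⟩
        simp only at this
        simp [this, u₀, hlt, hlt.ne]
      · simp [(mem_prefixFiber.1 hu).1, u₀]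
    have h1 : ∀ k, T i k = 1 → (Pi.single i x ᵥ* T) k = x := fun k hk => by
      simp [hk]
    rw [e, Matrix.add_vecMul, Matrix.add_vecMul]
    simp only [Pi.add_apply, h0.1, h0.2, h1 a ha, h1 b hb, zero_add, and_self]
  have hcard : ∀ p, (prefixFiber i (0 + 1) p).card = (prefixFiber i 0 p).card := by
    intro p
    have := sum_prefixFiber_add (i := i) (δ := Pi.single i 1) (by simp)
      (fun j hj => by simp [hj.ne]) 0 p fun _ => 1
    simpa only [Finset.sum_const, nsmul_eq_mul, mul_one, Nat.cast_inj] using this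
  -- The probability of the past `p`.
  let w : ({j : Fin n // j < i} → ZMod 2) → ℝ := fun p => (prefixFiber i 0 p).card * c
  have hw0 : ∀ p, 0 ≤ w p := fun p => by positivity
  have hw : ∑ p, w p = 1 := by
    have := sum_sum_prefixFiber_const (ι := Fin n) i 0 1
    simpa only [Finset.sum_const, nsmul_eq_mul, mul_one] using this
  have hmarg : ∀ x p z, HasSum (fun y : Fin n → Y => {y : Fin n → Y | (y a, y b) = z}.indicator
      (fun y => 1 / 2 * MultiKernelPolar.virtualChannel W T i x (y, p)) y)
      (w p * (1 / 2 * (W ((u₀ p ᵥ* T) a + x) z.1 * W ((u₀ p ᵥ* T) b + x) z.2))) := by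
    intro x p z
    have hcx : (prefixFiber i x p).card = (prefixFiber i 0 p).card := by
      have : x = 0 ∨ x = 0 + 1 := by revert x; decide
      rcases this with rfl | rfl
      · rfl
      · exact hcard p
    have h := hasSum_sum fun u (_ : u ∈ prefixFiber i x p) =>
      (hW.hasSum_pi_marginal (u ᵥ* T) hab z).mul_left (1 / 2 * c)
    rw [Finset.sum_congr rfl fun u hu' => by rw [(hu x p u hu').1, (hu x p u hu').2],
      Finset.sum_const, hcx, nsmul_eq_mul] at h
    rw [show w p * (1 / 2 * (W ((u₀ p ᵥ* T) a + x) z.1 * W ((u₀ p ᵥ* T) b + x) z.2)) =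
      (prefixFiber i 0 p).card * (1 / 2 * c * (W ((u₀ p ᵥ* T) a + x) z.1 *
        W ((u₀ p ᵥ* T) b + x) z.2)) by simp only [w]; ring]
    refine h.congr_fun fun y => ?_
    by_cases hy : y ∈ {y : Fin n → Y | (y a, y b) = z}
    · simp only [Set.indicator_of_mem hy, virtualChannel_apply, Finset.mul_sum]
      exact Finset.sum_congr rfl fun u _ => by rw [mul_assoc]
    · simp only [Set.indicator_of_notMem hy, mul_zero, Finset.sum_const_zero]
  have hsum : ∀ x p, Summable fun y : Fin n → Y =>
      1 / 2 * MultiKernelPolar.virtualChannel W T i x (y, p) := fun x p =>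
    (hV.hasSum_half x).summable.comp_injective (Prod.mk_left_injective p)
  have hsum2 : ∀ (p) (γ δ : ZMod 2),
      Summable fun z : Y × Y => w p * (1 / 2 * (W γ z.1 * W δ z.2)) := fun p γ δ =>
    (((hW.hasSum_one γ).summable.mul_of_nonneg (hW.hasSum_one δ).summable (hW.nonneg γ)
      (hW.nonneg δ)).mul_left _).mul_left _
  have hp : ∀ p, ∑' y : Fin n → Y,
      pairEntropy (1 / 2 * MultiKernelPolar.virtualChannel W T i 0 (y, p))
        (1 / 2 * MultiKernelPolar.virtualChannel W T i 1 (y, p)) ≤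
      w p * (condEntropy W - g) := by
    intro p
    refine (tsum_pairEntropy_le_of_fiber (fun y : Fin n → Y => (y a, y b))
      (fun y => hV.half_nonneg 0 _) (fun y => hV.half_nonneg 1 _) (hsum 0 p) (hsum 1 p)
      (hmarg 0 p) (hmarg 1 p) (hsum2 _ _ _) (hsum2 _ _ _)).trans ?_
    simp only [pairEntropy_mul_left (w p), add_zero]
    rw [tsum_mul_left]
    exact mul_le_mul_of_nonneg_left (hW.tsum_pairEntropy_two_le _ _) (hw0 p)
  have htot : condEntropy (MultiKernelPolar.virtualChannel W T i) = ∑ p, ∑' y : Fin n → Y,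
      pairEntropy (1 / 2 * MultiKernelPolar.virtualChannel W T i 0 (y, p))
        (1 / 2 * MultiKernelPolar.virtualChannel W T i 1 (y, p)) := by
    refine hV.hasSum_condEntropy.unique (hasSum_prod_of_fintype fun p => ?_)
    exact (hV.hasSum_condEntropy.summable.comp_injective (Prod.mk_left_injective p)).hasSum
  rw [htot]
  refine (Finset.sum_le_sum fun p _ => hp p).trans_eq ?_
  rw [← Finset.sum_mul, hw, one_mul]

end Kernel

/-! ### The recursive structure of the virtual channels -/

section Recursion

variable {Y : Type*}

/-- The virtual channel of a Kronecker product, with rows ordered lexicographically, arises from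
one polarization step applied to a virtual channel of the first factor. -/
lemma exists_equiv_virtualChannel_kronecker {Λ ι κ : Type*} [Fintype Λ] [LinearOrder Λ] [Fintype ι]
    [LinearOrder ι] [Fintype κ] [LinearOrder κ] (W : ZMod 2 → Y → ℝ) (e : Λ ≃ ι × κ)
    (hlt : ∀ a b, a < b ↔ (e a).1 < (e b).1 ∨ (e a).1 = (e b).1 ∧ (e a).2 < (e b).2)
    (G : Matrix ι ι (ZMod 2)) {T : Matrix κ κ (ZMod 2)} (hT : IsUnit T) (i : Λ) :
    ∃ E : ((Λ → Y) × ({j : Λ // j < i} → ZMod 2)) ≃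
        ((κ → (ι → Y) × ({b : ι // b < (e i).1} → ZMod 2)) × ({a : κ // a < (e i).2} → ZMod 2)),
      ∀ x z, virtualChannel (virtualChannel W G (e i).1) T (e i).2 x (E z) =
        virtualChannel W (Matrix.of fun a b => G (e a).1 (e b).1 * T (e a).2 (e b).2) i x z := by
  classical
  have hdet : IsUnit T.det := (Matrix.isUnit_iff_isUnit_det T).1 hT
  have hTi : ∀ v : κ → ZMod 2, (v ᵥ* T) ᵥ* T⁻¹ = v := fun v => by
    rw [Matrix.vecMul_vecMul, Matrix.mul_nonsing_inv T hdet, Matrix.vecMul_one]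
  have hiT : ∀ v : κ → ZMod 2, (v ᵥ* T⁻¹) ᵥ* T = v := fun v => by
    rw [Matrix.vecMul_vecMul, Matrix.nonsing_inv_mul T hdet, Matrix.vecMul_one]
  have hlt1 : ∀ (b : {b : ι // b < (e i).1}) (a : κ), e.symm (b, a) < i := fun b a =>
    (hlt _ _).2 (Or.inl (by simpa using b.2))
  have hlt2 : ∀ a : {a : κ // a < (e i).2}, e.symm ((e i).1, a) < i := fun a =>
    (hlt _ _).2 (Or.inr (by simpa using a.2))
  have hlt3 : ∀ j : {j : Λ // j < i}, ¬ (e j).1 < (e i).1 → (e j).1 = (e i).1 ∧ (e j).2 < (e i).2 :=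
    fun j h => ((hlt _ _).1 j.2).resolve_left h
  -- Blocks `u (b, ·)` with `b` before the current first digit lie entirely in the past. Copy `d` of
  -- the inner channel sees coordinate `d` of their images under `T`; invertibility recovers the
  -- blocks from these.
  let E : ((Λ → Y) × ({j : Λ // j < i} → ZMod 2)) ≃
      ((κ → (ι → Y) × ({b : ι // b < (e i).1} → ZMod 2)) × ({a : κ // a < (e i).2} → ZMod 2)) :=
    { toFun := fun z => (fun d => (fun c => z.1 (e.symm (c, d)),
          fun b => ((fun a => z.2 ⟨e.symm (b, a), hlt1 b a⟩) ᵥ* T) d),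
        fun a => z.2 ⟨e.symm ((e i).1, a), hlt2 a⟩)
      invFun := fun z => (fun j => (z.1 (e j).2).1 (e j).1, fun j =>
        if h : (e j).1 < (e i).1 then ((fun d => (z.1 d).2 ⟨(e j).1, h⟩) ᵥ* T⁻¹) (e j).2
        else z.2 ⟨(e j).2, (hlt3 j h).2⟩)
      left_inv := by
        rintro ⟨y, p⟩
        refine Prod.ext (funext fun j => by simp) (funext fun j => ?_)
        dsimp only
        split_ifs with h
        · rw [show (fun d => ((fun a => p ⟨e.symm ((e j).1, a), hlt1 ⟨(e j).1, h⟩ a⟩) ᵥ* T) d) =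
            (fun a => p ⟨e.symm ((e j).1, a), hlt1 ⟨(e j).1, h⟩ a⟩) ᵥ* T from rfl, hTi]
          simp
        · have := (hlt3 j h).1
          simp [← this]
      right_inv := by
        rintro ⟨w, q⟩
        refine Prod.ext (funext fun d => Prod.ext (funext fun c => by simp) (funext fun b => ?_))
          (funext fun a => ?_)
        · have : (fun a => if h : (e (e.symm ((b : ι), a))).1 < (e i).1 then
              ((fun d => (w d).2 ⟨(e (e.symm ((b : ι), a))).1, h⟩) ᵥ* T⁻¹) (e (e.symm ((b : ι), a))).2
              else q ⟨(e (e.symm ((b : ι), a))).2, (hlt3 ⟨e.symm (b, a), hlt1 b a⟩ h).2⟩) =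
              (fun d => (w d).2 b) ᵥ* T⁻¹ := by
            funext a
            simp [b.2]
          dsimp only
          rw [this, hiT]
        · simp }
  refine ⟨E, fun x z => ?_⟩
  have hvec : ∀ (u : Λ → ZMod 2) (c : ι) (d : κ),
      (u ᵥ* Matrix.of fun a b => G (e a).1 (e b).1 * T (e a).2 (e b).2) (e.symm (c, d)) =
      ((fun b => ((fun a => u (e.symm (b, a))) ᵥ* T) d) ᵥ* G) c := by
    intro u c d
    simp only [Matrix.vecMul, dotProduct, Matrix.of_apply, Equiv.apply_symm_apply, Finset.sum_mul]
    rw [← e.symm.sum_comp, Fintype.sum_prod_type]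
    refine Finset.sum_congr rfl fun b _ => Finset.sum_congr rfl fun a _ => ?_
    simp only [Equiv.apply_symm_apply]
    ring
  have hκ : 0 < Fintype.card κ := Fintype.card_pos_iff.2 ⟨(e i).2⟩
  have hι : 0 < Fintype.card ι := Fintype.card_pos_iff.2 ⟨(e i).1⟩
  have hconst : (1 / 2 : ℝ) ^ (Fintype.card κ - 1) *
      ((1 / 2 : ℝ) ^ (Fintype.card ι - 1)) ^ Fintype.card κ = (1 / 2 : ℝ) ^ (Fintype.card Λ - 1) := by
    rw [Fintype.card_congr e, Fintype.card_prod, ← pow_mul, ← pow_add]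
    congr 1
    obtain ⟨k, hk⟩ := Nat.exists_eq_succ_of_ne_zero hκ.ne'
    obtain ⟨r, hr⟩ := Nat.exists_eq_succ_of_ne_zero hι.ne'
    rw [hk, hr]
    simp only [Nat.succ_eq_add_one, Nat.add_sub_cancel]
    have : (r + 1) * (k + 1) = k + r * (k + 1) + 1 := by ring
    omega
  rw [virtualChannel_apply, virtualChannel_apply]
  simp only [virtualChannel_apply, Finset.prod_univ_sum, Finset.mul_sum, Finset.prod_mul_distrib,
    Finset.prod_const, Finset.card_univ, ← mul_assoc, hconst]
  rw [Finset.sum_sigma']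
  -- `t` completes the input of the kernel `T` and `ω d` that of copy `d` of the inner channel. Such
  -- data correspond to one vector `u`, block `b` of which has image `d ↦ ω d b` under `T`.
  refine Finset.sum_bij' (fun s _ => fun j => ((fun d => s.2 d (e j).1) ᵥ* T⁻¹) (e j).2)
    (fun u _ => ⟨fun a => u (e.symm ((e i).1, a)), fun d b => ((fun a => u (e.symm (b, a))) ᵥ* T) d⟩)
    ?_ ?_ ?_ ?_ ?_
  · rintro ⟨t, ω⟩ h
    simp only [Finset.mem_sigma, Fintype.mem_piFinset, mem_prefixFiber] at h ⊢
    obtain ⟨⟨h1, h2⟩, h3⟩ := h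
    have h4 : (fun d => ω d (e i).1) = t ᵥ* T := funext fun d => (h3 d).1
    refine ⟨by rw [h4, hTi, h1], fun j => ?_⟩
    by_cases hj : (e j).1 < (e i).1
    · have : (fun d => ω d (e j).1) =
          (fun a => z.2 ⟨e.symm ((e j).1, a), hlt1 ⟨(e j).1, hj⟩ a⟩) ᵥ* T :=
        funext fun d => (h3 d).2 ⟨(e j).1, hj⟩
      rw [this, hTi]
      simp
    · obtain ⟨h5, h6⟩ := hlt3 j hj
      rw [h5, h4, hTi, h2 ⟨(e j).2, h6⟩]
      change z.2 ⟨e.symm ((e i).1, (e j).2), _⟩ = _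
      refine congrArg z.2 (Subtype.ext ?_)
      change e.symm ((e i).1, (e j).2) = j
      rw [← h5, Prod.mk.eta, Equiv.symm_apply_apply]
  · intro u h
    simp only [Finset.mem_sigma, Fintype.mem_piFinset, mem_prefixFiber] at h ⊢
    obtain ⟨h1, h2⟩ := h
    refine ⟨⟨by simpa using h1, fun a => h2 ⟨e.symm ((e i).1, a), hlt2 a⟩⟩,
      fun d => ⟨trivial, fun b => ?_⟩⟩
    have : (fun a => u (e.symm ((b : ι), a))) = fun a => z.2 ⟨e.symm (b, a), hlt1 b a⟩ :=
      funext fun a => h2 ⟨e.symm (b, a), hlt1 b a⟩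
    rw [this]
    rfl
  · rintro ⟨t, ω⟩ h
    simp only [Finset.mem_sigma, Fintype.mem_piFinset, mem_prefixFiber] at h
    obtain ⟨⟨h1, h2⟩, h3⟩ := h
    have h4 : (fun d => ω d (e i).1) = t ᵥ* T := funext fun d => (h3 d).1
    simp only [Equiv.apply_symm_apply]
    refine Sigma.ext ?_ (heq_of_eq ?_)
    · simp only [h4, hTi]
    · funext d b
      exact congrFun (hiT fun d => ω d b) d
  · intro u h
    funext j
    dsimp only
    rw [show (fun d => ((fun a => u (e.symm ((e j).1, a))) ᵥ* T) d) =
      (fun a => u (e.symm ((e j).1, a))) ᵥ* T from rfl, hTi]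
    simp
  · rintro ⟨t, ω⟩ h
    congr 1
    rw [← e.symm.prod_comp, Fintype.prod_prod_type, Finset.prod_comm]
    refine Finset.prod_congr rfl fun c _ => Finset.prod_congr rfl fun d _ => ?_
    rw [hvec]
    simp only [Equiv.apply_symm_apply]
    rw [show (fun b => ((fun a => ((fun d => ω d b) ᵥ* T⁻¹) a) ᵥ* T) d) = ω d from
      funext fun b => congrFun (hiT fun d => ω d b) d]
    rfl

lemma exists_equiv_virtualChannel_unique {Λ : Type*} [Fintype Λ] [LinearOrder Λ] [Unique Λ]
    (W : ZMod 2 → Y → ℝ) {G : Matrix Λ Λ (ZMod 2)} (hG : G default default = 1) (i : Λ) :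
    ∃ E : ((Λ → Y) × ({j : Λ // j < i} → ZMod 2)) ≃ Y,
      ∀ x z, W x (E z) = virtualChannel W G i x z := by
  have : IsEmpty {j : Λ // j < i} := ⟨fun j => absurd j.2 (by simp [Subsingleton.elim j.1 i])⟩
  refine ⟨(Equiv.prodUnique _ _).trans (Equiv.funUnique Λ Y), fun x z => ?_⟩
  rw [virtualChannel_apply, Finset.sum_eq_single fun _ => x]
  · simp [Matrix.vecMul, dotProduct, hG]
  · intro u hu hne
    refine absurd (funext fun j => ?_) hne
    rw [Subsingleton.elim j i]
    exact (mem_prefixFiber.1 hu).1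
  · intro h
    exact absurd (mem_prefixFiber.2 ⟨rfl, fun j => isEmptyElim j⟩) h

/-- Splitting off the last digit of a mixed radix number. -/
def mixedRadixSplit (l : ℕ → ℕ) (m : ℕ) : MixedRadix l (m + 1) ≃ MixedRadix l m × Fin (l m) where
  toFun b := (toLex fun k : Fin m => ofLex b k.castSucc, ofLex b (Fin.last m))
  invFun z := toLex (Fin.snoc (α := fun k : Fin (m + 1) => Fin (l k)) (ofLex z.1) z.2)
  left_inv b := by
    refine ofLex.injective (funext fun k => ?_)
    induction k using Fin.lastCases with
    | last => simp
    | cast k => simp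
  right_inv z := by
    refine Prod.ext (ofLex.injective (funext fun k => ?_)) ?_
    · simp
    · simp

lemma lt_iff_mixedRadixSplit {l : ℕ → ℕ} {m : ℕ} (a b : MixedRadix l (m + 1)) :
    a < b ↔ (mixedRadixSplit l m a).1 < (mixedRadixSplit l m b).1 ∨
      (mixedRadixSplit l m a).1 = (mixedRadixSplit l m b).1 ∧
        (mixedRadixSplit l m a).2 < (mixedRadixSplit l m b).2 := by
  constructor
  · rintro ⟨k, h1, h2⟩
    induction k using Fin.lastCases with
    | last =>
      refine Or.inr ⟨ofLex.injective (funext fun j => h1 _ (Fin.castSucc_lt_last j)), h2⟩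
    | cast k =>
      exact Or.inl ⟨k, fun j hj => h1 _ (Fin.castSucc_lt_castSucc_iff.2 hj), h2⟩
  · rintro (⟨k, h1, h2⟩ | ⟨h1, h2⟩)
    · refine ⟨k.castSucc, fun j hj => ?_, h2⟩
      induction j using Fin.lastCases with
      | last => exact absurd hj (not_lt.2 (Fin.le_last _))
      | cast j => exact h1 j (Fin.castSucc_lt_castSucc_iff.1 hj)
    · refine ⟨Fin.last m, fun j hj => ?_, h2⟩
      induction j using Fin.lastCases with
      | last => exact absurd hj (lt_irrefl _)
      | cast j => exact congrFun (congrArg ofLex h1) j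

lemma transformMatrix_succ {l : ℕ → ℕ} (T : ∀ k, Matrix (Fin (l k)) (Fin (l k)) (ZMod 2)) (m : ℕ) :
    transformMatrix T (m + 1) = Matrix.of fun a b =>
      transformMatrix T m (mixedRadixSplit l m a).1 (mixedRadixSplit l m b).1 *
        T m (mixedRadixSplit l m a).2 (mixedRadixSplit l m b).2 := by
  ext a b
  simp only [transformMatrix, Matrix.of_apply, Fin.prod_univ_castSucc]
  rfl

end Recursion

/-! ### The tree of virtual channels -/

section Tree

variable {Y : Type*} {W : ZMod 2 → Y → ℝ} {l : ℕ → ℕ}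
  {T : ∀ k, Matrix (Fin (l k)) (Fin (l k)) (ZMod 2)}

/-- The virtual channel reached after `m` steps along the digit sequence `b`. -/
noncomputable def treeChannel (W : ZMod 2 → Y → ℝ)
    (T : ∀ k, Matrix (Fin (l k)) (Fin (l k)) (ZMod 2)) (m : ℕ) (b : ∀ k, Fin (l k)) :=
  virtualChannel W (transformMatrix T m) (toLex fun k : Fin m => b k)

/-- The output alphabet depends on the digits, so agreement of channels is expressed by a bijection
of outputs. -/
lemma treeChannel_congr (m : ℕ) {b b' : ∀ k, Fin (l k)} (h : ∀ k < m, b k = b' k) :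
    ∃ E : ((MixedRadix l m → Y) × ({j // j < toLex fun k : Fin m => b k} → ZMod 2)) ≃
        ((MixedRadix l m → Y) × ({j // j < toLex fun k : Fin m => b' k} → ZMod 2)),
      ∀ x z, treeChannel W T m b' x (E z) = treeChannel W T m b x z := by
  have e : (fun k : Fin m => b k) = fun k : Fin m => b' k := funext fun k => h k k.2
  unfold treeChannel
  rw [e]
  exact ⟨Equiv.refl _, fun _ _ => rfl⟩

lemma exists_equiv_treeChannel_zero (b : ∀ k, Fin (l k)) :
    ∃ E : ((MixedRadix l 0 → Y) × ({j // j < toLex fun k : Fin 0 => b k} → ZMod 2)) ≃ Y,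
      ∀ x z, W x (E z) = treeChannel W T 0 b x z := by
  let _ : Unique (MixedRadix l 0) := inferInstanceAs (Unique (∀ k : Fin 0, Fin (l k)))
  exact exists_equiv_virtualChannel_unique W (by simp [transformMatrix]) _

lemma exists_equiv_treeChannel_succ (hT : ∀ k, IsUnit (T k)) (m : ℕ) (b : ∀ k, Fin (l k)) :
    ∃ E : ((MixedRadix l (m + 1) → Y) ×
        ({j // j < toLex fun k : Fin (m + 1) => b k} → ZMod 2)) ≃
        ((Fin (l m) → (MixedRadix l m → Y) × ({j // j < toLex fun k : Fin m => b k} → ZMod 2)) ×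
          ({j // j < b m} → ZMod 2)),
      ∀ x z, virtualChannel (treeChannel W T m b) (T m) (b m) x (E z) =
        treeChannel W T (m + 1) b x z := by
  have := exists_equiv_virtualChannel_kronecker W (mixedRadixSplit l m) lt_iff_mixedRadixSplit
    (transformMatrix T m) (hT m) (toLex fun k : Fin (m + 1) => b k)
  rw [← transformMatrix_succ] at this
  exact this

lemma isBinaryChannel_treeChannel (hW : IsBinaryChannel W) (hT : ∀ k, IsUnit (T k)) (m : ℕ)
    (b : ∀ k, Fin (l k)) : IsBinaryChannel (treeChannel W T m b) := by
  induction m with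
  | zero =>
    obtain ⟨E, hE⟩ := exists_equiv_treeChannel_zero (W := W) (T := T) b
    exact hW.congr E hE
  | succ m ih =>
    obtain ⟨E, hE⟩ := exists_equiv_treeChannel_succ (W := W) hT m b
    exact (ih.virtualChannel (T m) (b m)).congr E hE

/-- The Bhattacharyya parameter after `m` steps along a digit sequence. -/
noncomputable def treeBhattacharyya (W : ZMod 2 → Y → ℝ)
    (T : ∀ k, Matrix (Fin (l k)) (Fin (l k)) (ZMod 2))
    (m : ℕ) (b : ∀ k, Fin (l k)) : ℝ := bhattacharyya (treeChannel W T m b)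

/-- The mutual information after `m` steps along a digit sequence. -/
noncomputable def treeInfo (W : ZMod 2 → Y → ℝ)
    (T : ∀ k, Matrix (Fin (l k)) (Fin (l k)) (ZMod 2))
    (m : ℕ) (b : ∀ k, Fin (l k)) : ℝ := 1 - condEntropy (treeChannel W T m b) / Real.log 2

lemma treeBhattacharyya_dependsOn (m : ℕ) : DependsOn (treeBhattacharyya W T m) (Set.Iio m) := by
  intro b b' h
  obtain ⟨E, hE⟩ := treeChannel_congr (W := W) (T := T) m fun k hk => h k hk
  exact bhattacharyya_congr E hE

lemma treeInfo_dependsOn (m : ℕ) : DependsOn (treeInfo W T m) (Set.Iio m) := by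
  intro b b' h
  obtain ⟨E, hE⟩ := treeChannel_congr (W := W) (T := T) m fun k hk => h k hk
  simp only [treeInfo, condEntropy_congr E hE]

lemma treeBhattacharyya_zero (b : ∀ k, Fin (l k)) : treeBhattacharyya W T 0 b = bhattacharyya W := by
  obtain ⟨E, hE⟩ := exists_equiv_treeChannel_zero (W := W) (T := T) b
  exact bhattacharyya_congr E hE

lemma treeInfo_zero (hW : IsBinaryChannel W) (b : ∀ k, Fin (l k)) :
    treeInfo W T 0 b = mutualInfo W := by
  obtain ⟨E, hE⟩ := exists_equiv_treeChannel_zero (W := W) (T := T) b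
  rw [treeInfo, hW.mutualInfo_eq, condEntropy_congr E hE]

lemma treeBhattacharyya_succ (hT : ∀ k, IsUnit (T k)) (m : ℕ) (b : ∀ k, Fin (l k)) :
    treeBhattacharyya W T (m + 1) b =
      bhattacharyya (virtualChannel (treeChannel W T m b) (T m) (b m)) := by
  obtain ⟨E, hE⟩ := exists_equiv_treeChannel_succ (W := W) hT m b
  exact bhattacharyya_congr E hE

lemma condEntropy_treeChannel_succ_update (hT : ∀ k, IsUnit (T k)) (m : ℕ) (b : ∀ k, Fin (l k))
    (i : Fin (l m)) :
    condEntropy (treeChannel W T (m + 1) (Function.update b m i)) =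
      condEntropy (virtualChannel (treeChannel W T m b) (T m) i) := by
  obtain ⟨E, hE⟩ := exists_equiv_treeChannel_succ (W := W) hT m (Function.update b m i)
  rw [condEntropy_congr E hE, Function.update_self]
  have e : (fun k : Fin m => Function.update b m i k) = fun k : Fin m => b k :=
    funext fun k => Function.update_of_ne k.2.ne _ _
  unfold treeChannel
  rw [e]

lemma pow_le_treeBhattacharyya_succ (hW : IsBinaryChannel W) (hT : ∀ k, IsUnit (T k)) (m : ℕ)
    (b : ∀ k, Fin (l k)) :
    treeBhattacharyya W T m b ^ partialDistance (T m) (b m) ≤ treeBhattacharyya W T (m + 1) b := by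
  obtain ⟨δ, h1, h2, h3⟩ := exists_hammingNorm_eq_partialDistance (T m) (b m)
  rw [treeBhattacharyya_succ hT, ← h3]
  exact (isBinaryChannel_treeChannel hW hT m b).pow_le_bhattacharyya_virtualChannel (T m) h1 h2

lemma treeBhattacharyya_succ_le (hW : IsBinaryChannel W) (hT : ∀ k, IsUnit (T k)) (m : ℕ)
    (b : ∀ k, Fin (l k)) :
    treeBhattacharyya W T (m + 1) b ≤
      2 ^ l m * treeBhattacharyya W T m b ^ partialDistance (T m) (b m) := by
  rw [treeBhattacharyya_succ hT]
  exact (isBinaryChannel_treeChannel hW hT m b).bhattacharyya_virtualChannel_le (T m)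
    fun δ h1 h2 => partialDistance_le_hammingNorm h1 h2

lemma treeInfo_nonneg (hW : IsBinaryChannel W) (hT : ∀ k, IsUnit (T k)) (m : ℕ)
    (b : ∀ k, Fin (l k)) : 0 ≤ treeInfo W T m b := by
  rw [treeInfo, sub_nonneg, div_le_one (Real.log_pos one_lt_two)]
  exact (isBinaryChannel_treeChannel hW hT m b).condEntropy_le_log_two

lemma treeInfo_le_one (hW : IsBinaryChannel W) (hT : ∀ k, IsUnit (T k)) (m : ℕ)
    (b : ∀ k, Fin (l k)) : treeInfo W T m b ≤ 1 :=
  sub_le_self _ (div_nonneg (isBinaryChannel_treeChannel hW hT m b).condEntropy_nonneg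
    (Real.log_pos one_lt_two).le)

lemma condEntropy_treeChannel (m : ℕ) (b : ∀ k, Fin (l k)) :
    condEntropy (treeChannel W T m b) = (1 - treeInfo W T m b) * Real.log 2 := by
  have := (Real.log_pos one_lt_two).ne'
  rw [treeInfo]
  field_simp
  ring

lemma sq_treeBhattacharyya_le (hW : IsBinaryChannel W) (hT : ∀ k, IsUnit (T k)) (m : ℕ)
    (b : ∀ k, Fin (l k)) :
    treeBhattacharyya W T m b ^ 2 ≤ 2 * ((1 - treeInfo W T m b) * Real.log 2) := by
  rw [← condEntropy_treeChannel]
  exact (isBinaryChannel_treeChannel hW hT m b).sq_bhattacharyya_le_two_mul_condEntropy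

lemma le_treeBhattacharyya (hW : IsBinaryChannel W) (hT : ∀ k, IsUnit (T k)) (m : ℕ)
    (b : ∀ k, Fin (l k)) :
    (1 - treeInfo W T m b) * Real.log 2 ≤ treeBhattacharyya W T m b := by
  rw [← condEntropy_treeChannel]
  exact (isBinaryChannel_treeChannel hW hT m b).condEntropy_le_bhattacharyya

lemma sum_treeInfo_update (hW : IsBinaryChannel W) (hT : ∀ k, IsUnit (T k)) (m : ℕ)
    (b : ∀ k, Fin (l k)) :
    ∑ i, treeInfo W T (m + 1) (Function.update b m i) = l m * treeInfo W T m b := by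
  simp only [treeInfo, condEntropy_treeChannel_succ_update hT, Finset.sum_sub_distrib,
    ← Finset.sum_div]
  rw [(isBinaryChannel_treeChannel hW hT m b).sum_condEntropy_virtualChannel (hT m)]
  simp
  ring

/-- A kernel with a partial distance exceeding one has an index at which the mutual information
increases by a definite amount. -/
lemma exists_treeInfo_update_ge (hW : IsBinaryChannel W) (hT : ∀ k, IsUnit (T k)) {m : ℕ}
    (hD : ∃ i, 2 ≤ partialDistance (T m) i) (b : ∀ k, Fin (l k)) :
    ∃ i, treeInfo W T m b + Real.log 2 ^ 2 / 4 * (treeInfo W T m b * (1 - treeInfo W T m b) ^ 2) ≤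
      treeInfo W T (m + 1) (Function.update b m i) := by
  obtain ⟨i, a, c, hac, ha, hc, hδ⟩ := exists_two_columns hD (hT m)
  have hV := isBinaryChannel_treeChannel hW hT m b
  refine ⟨i, ?_⟩
  have h1 := hV.condEntropy_virtualChannel_le_of_columns hac ha hc hδ
  rw [← condEntropy_treeChannel_succ_update hT, condEntropy_treeChannel,
    condEntropy_treeChannel] at h1
  have h2 := hV.sq_bhattacharyya_le_one_sub
  have h3 := hV.condEntropy_le_bhattacharyya
  rw [condEntropy_treeChannel] at h2 h3
  have h4 := hV.bhattacharyya_le_one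
  have h5 := IsBinaryChannel.bhattacharyya_nonneg (treeChannel W T m b)
  have h6 := treeInfo_nonneg hW hT m b
  have h7 := treeInfo_le_one hW hT m b
  have hL := Real.log_pos one_lt_two
  set x := treeInfo W T m b
  set x' := treeInfo W T (m + 1) (Function.update b m i)
  set r := bhattacharyya (treeChannel W T m b)
  set L := Real.log 2
  -- From `r ^ 2 ≤ 1 - x L` one gets `x L ≤ 1 - r ^ 2 ≤ 2 (1 - r)`. Together with `(1 - x) L ≤ r`,
  -- the entropy drop `(1 - r) r ^ 2 / 2` is at least `L ^ 3 x (1 - x) ^ 2 / 4`; dividing by `L`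
  -- gives the constant `L ^ 2 / 4`.
  have h8 : x * L ≤ 2 * (1 - r) := by nlinarith
  have h9 : ((1 - x) * L) ^ 2 ≤ r ^ 2 :=
    pow_le_pow_left₀ (mul_nonneg (by linarith) hL.le) h3 2
  have h10 : x * L * ((1 - x) * L) ^ 2 ≤ 2 * (1 - r) * r ^ 2 :=
    mul_le_mul h8 h9 (sq_nonneg _) (by linarith)
  have h11 : L * (x + L ^ 2 / 4 * (x * (1 - x) ^ 2)) ≤ L * x' := by nlinarith
  exact le_of_mul_le_mul_left h11 hL

end Tree

/-! ### Processes driven by independent uniform digits -/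

section Digits

variable {Ω : Type*} [mΩ : MeasurableSpace Ω] {P : Measure Ω} [IsProbabilityMeasure P] {l : ℕ → ℕ}
  {B : ∀ k, Ω → Fin (l k)}

lemma exists_eq_comp_of_dependsOn {f : (∀ k, Fin (l k)) → ℝ} {m : ℕ}
    (hf : DependsOn f (Set.Iio m)) :
    ∃ g : (∀ k : Finset.range m, Fin (l k)) → ℝ, ∀ b, f b = g fun k => b k := by
  rw [← Finset.coe_range] at hf
  obtain ⟨g, hg⟩ := dependsOn_iff_exists_comp.1 hf
  exact ⟨g, fun b => congrFun hg b⟩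

lemma measurable_digits (hBm : ∀ k, Measurable (B k)) (s : Finset ℕ) :
    Measurable fun ω (k : s) => B k ω :=
  measurable_pi_lambda _ fun k => hBm k

lemma measurable_of_dependsOn (hBm : ∀ k, Measurable (B k)) {f : (∀ k, Fin (l k)) → ℝ} {m : ℕ}
    (hf : DependsOn f (Set.Iio m)) : Measurable fun ω => f fun k => B k ω := by
  obtain ⟨g, hg⟩ := exists_eq_comp_of_dependsOn hf
  simp only [hg]
  exact (measurable_of_countable g).comp (measurable_digits hBm (Finset.range m))

lemma integrable_of_dependsOn (hBm : ∀ k, Measurable (B k)) {f : (∀ k, Fin (l k)) → ℝ} {m : ℕ}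
    (hf : DependsOn f (Set.Iio m)) : Integrable (fun ω => f fun k => B k ω) P := by
  have hm := measurable_of_dependsOn hBm hf
  obtain ⟨g, hg⟩ := exists_eq_comp_of_dependsOn hf
  refine Integrable.of_bound hm.aestronglyMeasurable (∑ v, ‖g v‖) (ae_of_all _ fun ω => ?_)
  rw [hg]
  exact Finset.single_le_sum (f := fun v => ‖g v‖) (fun _ _ => norm_nonneg _) (Finset.mem_univ _)

lemma dependsOn_update {f : (∀ k, Fin (l k)) → ℝ} {m : ℕ}
    (hf : DependsOn f (Set.Iio (m + 1))) (i : Fin (l m)) :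
    DependsOn (fun b => f (Function.update b m i)) (Set.Iio m) := by
  intro b b' h
  refine hf fun k hk => ?_
  by_cases hkm : k = m
  · subst hkm; simp
  · rw [Function.update_of_ne hkm, Function.update_of_ne hkm]
    exact h k (lt_of_le_of_ne (Nat.le_of_lt_succ hk) hkm)

/-- The last digit can be averaged out. -/
lemma integral_eq_integral_average (hBm : ∀ k, Measurable (B k)) (hBi : iIndepFun B P)
    (hBu : ∀ k b, P.real (B k ⁻¹' {b}) = 1 / (l k : ℝ)) {f : (∀ k, Fin (l k)) → ℝ} {m : ℕ}
    (hf : DependsOn f (Set.Iio (m + 1))) :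
    ∫ ω, f (fun k => B k ω) ∂P =
      ∫ ω, 1 / (l m : ℝ) * ∑ i, f (Function.update (fun k => B k ω) m i) ∂P := by
  have hint : ∀ i, Integrable (fun ω => f (Function.update (fun k => B k ω) m i)) P := fun i =>
    integrable_of_dependsOn hBm (dependsOn_update hf i)
  have hmeas : ∀ i, Measurable fun ω => (B m ⁻¹' {i}).indicator (1 : Ω → ℝ) ω := fun i =>
    measurable_one.indicator (hBm m (measurableSet_singleton i))
  have h1 : ∀ ω, f (fun k => B k ω) = ∑ i, (B m ⁻¹' {i}).indicator (1 : Ω → ℝ) ω *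
      f (Function.update (fun k => B k ω) m i) := by
    intro ω
    rw [Finset.sum_eq_single (B m ω)]
    · rw [Set.indicator_of_mem (by simp), Pi.one_apply, one_mul]
      congr 1
      exact (Function.update_eq_self m fun k => B k ω).symm
    · intro i _ hi
      rw [Set.indicator_of_notMem (by simpa using hi.symm), zero_mul]
    · simp
  have h2 : ∀ i, ∫ ω, (B m ⁻¹' {i}).indicator (1 : Ω → ℝ) ω *
      f (Function.update (fun k => B k ω) m i) ∂P =
      1 / (l m : ℝ) * ∫ ω, f (Function.update (fun k => B k ω) m i) ∂P := by
    intro i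
    obtain ⟨g, hg⟩ := exists_eq_comp_of_dependsOn (dependsOn_update hf i)
    have hind : IndepFun (fun ω => (B m ⁻¹' {i}).indicator (1 : Ω → ℝ) ω)
        (fun ω => f (Function.update (fun k => B k ω) m i)) P := by
      simp only [hg]
      -- The indicator involves only digit `m`, the updated function only the digits before it.
      have := hBi.indepFun_finset {m} (Finset.range m) (by simp) hBm
      exact this.comp (φ := fun v : (∀ k : ({m} : Finset ℕ), Fin (l k)) =>
        ({i} : Set (Fin (l m))).indicator (1 : Fin (l m) → ℝ) (v ⟨m, by simp⟩)) (ψ := g)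
        (measurable_of_countable _) (measurable_of_countable _)
    rw [hind.integral_fun_mul_eq_mul_integral (hmeas i).aestronglyMeasurable
      (hint i).aestronglyMeasurable, integral_indicator_one (hBm m (measurableSet_singleton i)), hBu]
  have hint' : ∀ i, Integrable (fun ω => (B m ⁻¹' {i}).indicator (1 : Ω → ℝ) ω *
      f (Function.update (fun k => B k ω) m i)) P := fun i => by
    refine ((hint i).indicator (hBm m (measurableSet_singleton i))).congr (ae_of_all _ fun ω => ?_)
    by_cases h : ω ∈ B m ⁻¹' {i}
    · simp only [Set.indicator_of_mem h, Pi.one_apply, one_mul]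
    · simp only [Set.indicator_of_notMem h, zero_mul]
  simp only [h1]
  rw [integral_finsetSum _ fun i _ => hint' i, Finset.sum_congr rfl fun i _ => h2 i,
    ← Finset.mul_sum, ← integral_finsetSum _ fun i _ => hint i, ← integral_const_mul]

/-- The filtration generated by the digits. -/
def digitFiltration (hBm : ∀ k, Measurable (B k)) : Filtration ℕ mΩ where
  seq m := MeasurableSpace.comap (fun ω (k : Finset.range m) => B k ω) inferInstance
  mono' m n hmn := by
    have : Measurable[MeasurableSpace.comap (fun ω (k : Finset.range n) => B k ω) inferInstance]
        fun ω (k : Finset.range m) => B k ω :=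
      (measurable_of_countable fun (v : ∀ k : Finset.range n, Fin (l k)) (k : Finset.range m) =>
        v ⟨k, Finset.range_mono hmn k.2⟩).comp (comap_measurable _)
    exact this.comap_le
  le' m := (measurable_digits hBm _).comap_le

/-- An event of the first `m` digits has an indicator unaffected by updating digit `m`, so averaging
that digit in the integral over the event replaces `f (m + 1)` by `f m`. -/
lemma martingale_of_average (hBm : ∀ k, Measurable (B k)) (hBi : iIndepFun B P)
    (hBu : ∀ k b, P.real (B k ⁻¹' {b}) = 1 / (l k : ℝ)) (hl : ∀ k, 0 < l k)
    {f : ℕ → (∀ k, Fin (l k)) → ℝ} (hf : ∀ m, DependsOn (f m) (Set.Iio m))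
    (hsum : ∀ m b, ∑ i, f (m + 1) (Function.update b m i) = l m * f m b) :
    Martingale (fun m ω => f m fun k => B k ω) (digitFiltration hBm) P := by
  refine martingale_nat (fun m => ?_) (fun m => integrable_of_dependsOn hBm (hf m)) fun m => ?_
  · obtain ⟨g, hg⟩ := exists_eq_comp_of_dependsOn (hf m)
    simp only [hg]
    exact ((measurable_of_countable g).comp (comap_measurable _)).stronglyMeasurable
  · refine ae_eq_condExp_of_forall_setIntegral_eq ((digitFiltration hBm).le m)
      (integrable_of_dependsOn hBm (hf (m + 1)))
      (fun s _ _ => (integrable_of_dependsOn hBm (hf m)).integrableOn) ?_ ?_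
    · rintro s ⟨S, hS, rfl⟩ -
      have hs : MeasurableSet ((fun ω (k : Finset.range m) => B k ω) ⁻¹' S) :=
        measurable_digits hBm _ hS
      rw [← integral_indicator hs, ← integral_indicator hs]
      have key : ∀ (F : (∀ k, Fin (l k)) → ℝ),
          ((fun ω (k : Finset.range m) => B k ω) ⁻¹' S).indicator (fun ω => F fun k => B k ω) =
          fun ω => (fun b : (∀ k, Fin (l k)) => S.indicator (1 : (∀ k : Finset.range m, Fin (l k)) → ℝ)
            (fun k : Finset.range m => b k) * F b) fun k => B k ω := by
        intro F
        funext ω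
        by_cases h : (fun k : Finset.range m => B k ω) ∈ S
        · rw [Set.indicator_of_mem (show ω ∈ (fun ω (k : Finset.range m) => B k ω) ⁻¹' S from h)]
          simp [Set.indicator_of_mem h]
        · rw [Set.indicator_of_notMem
            (show ω ∉ (fun ω (k : Finset.range m) => B k ω) ⁻¹' S from h)]
          simp [Set.indicator_of_notMem h]
      rw [key, key]
      symm
      rw [integral_eq_integral_average hBm hBi hBu (m := m)]
      · refine integral_congr_ae (ae_of_all _ fun ω => ?_)
        have hup : ∀ i, (fun k : Finset.range m =>
            Function.update (fun k => B k ω) m i (k : ℕ)) = fun k : Finset.range m => B k ω :=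
          fun i => funext fun k => Function.update_of_ne (Finset.mem_range.1 k.2).ne _ _
        simp only [hup, ← Finset.mul_sum, hsum]
        have : (l m : ℝ) ≠ 0 := by exact_mod_cast (hl m).ne'
        field_simp
      · intro b b' h
        have : (fun k : Finset.range m => b k) = fun k : Finset.range m => b' k :=
          funext fun k => h k ((Finset.mem_range.1 k.2).trans (Nat.lt_succ_self m))
        simp only [this, hf (m + 1) h]
    · obtain ⟨g, hg⟩ := exists_eq_comp_of_dependsOn (hf m)
      simp only [hg]
      exact ((measurable_of_countable g).comp
        (comap_measurable _)).stronglyMeasurable.aestronglyMeasurable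

lemma exists_ae_tendsto (hBm : ∀ k, Measurable (B k)) (hBi : iIndepFun B P)
    (hBu : ∀ k b, P.real (B k ⁻¹' {b}) = 1 / (l k : ℝ)) (hl : ∀ k, 0 < l k)
    {f : ℕ → (∀ k, Fin (l k)) → ℝ} (hf : ∀ m, DependsOn (f m) (Set.Iio m))
    (h0 : ∀ m b, 0 ≤ f m b) (h1 : ∀ m b, f m b ≤ 1)
    (hsum : ∀ m b, ∑ i, f (m + 1) (Function.update b m i) = l m * f m b) :
    ∃ X : Ω → ℝ, Measurable X ∧
      ∀ᵐ ω ∂P, Tendsto (fun m => f m fun k => B k ω) atTop (𝓝 (X ω)) := by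
  have hM := martingale_of_average hBm hBi hBu hl hf hsum
  refine measurable_limit_of_tendsto_metrizable_ae
    (fun m => (measurable_of_dependsOn hBm (hf m)).aemeasurable)
    (hM.submartingale.exists_ae_tendsto_of_bdd (R := 1) fun m => ?_)
  refine (eLpNorm_le_of_ae_bound (C := 1) (ae_of_all _ fun ω => ?_)).trans ?_
  · rw [Real.norm_of_nonneg (h0 _ _)]; exact h1 _ _
  · simp

/-- A bounded martingale driven by uniform digits which, infinitely often, has a definite increase
in one direction unless it is close to `0` or `1`, converges to `0` or `1`. -/
lemma exists_ae_tendsto_zero_or_one (hBm : ∀ k, Measurable (B k)) (hBi : iIndepFun B P)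
    (hBu : ∀ k b, P.real (B k ⁻¹' {b}) = 1 / (l k : ℝ)) (hl : ∀ k, 0 < l k) {L : ℕ}
    (hL : ∀ k, l k ≤ L)
    {f : ℕ → (∀ k, Fin (l k)) → ℝ} (hf : ∀ m, DependsOn (f m) (Set.Iio m))
    (h0 : ∀ m b, 0 ≤ f m b) (h1 : ∀ m b, f m b ≤ 1)
    (hsum : ∀ m b, ∑ i, f (m + 1) (Function.update b m i) = l m * f m b)
    {c : ℝ} (hc : 0 < c) (hjump : ∃ᶠ m in atTop, ∀ b, ∃ i,
      f m b + c * (f m b * (1 - f m b) ^ 2) ≤ f (m + 1) (Function.update b m i))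
    {a : ℝ} (ha : ∀ b, f 0 b = a) :
    ∃ A : Set Ω, MeasurableSet A ∧ P.real A = a ∧
      (∀ᵐ ω ∂P, ω ∈ A → Tendsto (fun m => f m fun k => B k ω) atTop (𝓝 1)) ∧
      ∀ᵐ ω ∂P, ω ∉ A → Tendsto (fun m => f m fun k => B k ω) atTop (𝓝 0) := by
  obtain ⟨X, hXm, hX⟩ := exists_ae_tendsto hBm hBi hBu hl hf h0 h1 hsum
  have hm : ∀ m, Measurable fun ω => f m fun k => B k ω := fun m =>
    measurable_of_dependsOn hBm (hf m)
  have hX0 : ∀ᵐ ω ∂P, 0 ≤ X ω := hX.mono fun ω h => ge_of_tendsto' h fun m => h0 _ _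
  have hX1 : ∀ᵐ ω ∂P, X ω ≤ 1 := hX.mono fun ω h => le_of_tendsto' h fun m => h1 _ _
  have hpsi : ∀ x : ℝ, 0 ≤ x → x ≤ 1 → 0 ≤ x * (1 - x) ^ 2 ∧ x * (1 - x) ^ 2 ≤ 1 := by
    intro x hx hx'
    refine ⟨by positivity, ?_⟩
    have : (1 - x) ^ 2 ≤ 1 := pow_le_one₀ (by linarith) (by linarith)
    nlinarith
  have hlim1 : Tendsto (fun m => ∫ ω, (f m fun k => B k ω) * (1 - f m fun k => B k ω) ^ 2 ∂P)
      atTop (𝓝 (∫ ω, X ω * (1 - X ω) ^ 2 ∂P)) := by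
    refine tendsto_integral_of_dominated_convergence (fun _ => 1)
      (fun m => ((hm m).mul ((measurable_const.sub (hm m)).pow_const 2)).aestronglyMeasurable)
      (integrable_const _) (fun m => ae_of_all _ fun ω => ?_) (hX.mono fun ω h => ?_)
    · have := hpsi _ (h0 m fun k => B k ω) (h1 m fun k => B k ω)
      rw [Real.norm_of_nonneg this.1]; exact this.2
    · exact h.mul ((tendsto_const_nhds.sub h).pow 2)
  have hlim2 : Tendsto (fun m => ∫ ω, |(f (m + 1) fun k => B k ω) - f m fun k => B k ω| ∂P)
      atTop (𝓝 0) := by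
    have : Tendsto (fun m => ∫ ω, |(f (m + 1) fun k => B k ω) - f m fun k => B k ω| ∂P)
        atTop (𝓝 (∫ _, (0 : ℝ) ∂P)) := by
      refine tendsto_integral_of_dominated_convergence (fun _ => 1)
        (fun m => ((hm (m + 1)).sub (hm m)).abs.aestronglyMeasurable)
        (integrable_const _) (fun m => ae_of_all _ fun ω => ?_) (hX.mono fun ω h => ?_)
      · rw [Real.norm_eq_abs, abs_abs, abs_le]
        constructor <;> linarith [h0 m fun k => B k ω, h1 m fun k => B k ω,
          h0 (m + 1) fun k => B k ω, h1 (m + 1) fun k => B k ω]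
      · simpa using ((h.comp (tendsto_add_atTop_nat 1)).sub h).abs
    simpa using this
  have hLpos : (0 : ℝ) < L := by exact_mod_cast (hl 0).trans_le (hL 0)
  -- At a jump time, one digit value, of probability `1 / l m ≥ 1 / L`, already contributes its
  -- definite increase to the mean absolute increment.
  have hfreq : ∃ᶠ m in atTop, 0 ≤ ∫ ω, |(f (m + 1) fun k => B k ω) - f m fun k => B k ω| ∂P -
      c / L * ∫ ω, (f m fun k => B k ω) * (1 - f m fun k => B k ω) ^ 2 ∂P := by
    refine hjump.mono fun m hj => ?_
    have hdep : DependsOn (fun b => |f (m + 1) b - f m b|) (Set.Iio (m + 1)) := by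
      intro b b' h
      simp only [hf (m + 1) h, hf m fun k hk => h k (Set.Iio_subset_Iio (Nat.le_succ m) hk)]
    have hdep2 : DependsOn (fun b => f m b * (1 - f m b) ^ 2) (Set.Iio m) := by
      intro b b' h
      simp only [hf m h]
    have hdep3 : DependsOn (fun b => 1 / (l m : ℝ) * ∑ i,
        |f (m + 1) (Function.update b m i) - f m (Function.update b m i)|) (Set.Iio m) := by
      intro b b' h
      simp only
      congr 1
      exact Finset.sum_congr rfl fun i _ => dependsOn_update hdep i h
    rw [sub_nonneg, integral_eq_integral_average hBm hBi hBu hdep, ← integral_const_mul]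
    refine integral_mono ((integrable_of_dependsOn hBm hdep2).const_mul _)
      (integrable_of_dependsOn hBm hdep3) fun ω => ?_
    obtain ⟨i, hi⟩ := hj fun k => B k ω
    have hup : f m (Function.update (fun k => B k ω) m i) = f m fun k => B k ω :=
      hf m fun k hk => Function.update_of_ne (ne_of_lt hk) _ _
    have hle : c * ((f m fun k => B k ω) * (1 - f m fun k => B k ω) ^ 2) ≤
        ∑ i, |f (m + 1) (Function.update (fun k => B k ω) m i) -
          f m (Function.update (fun k => B k ω) m i)| := by
      refine le_trans ?_ (Finset.single_le_sum (fun _ _ => abs_nonneg _) (Finset.mem_univ i))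
      rw [hup]
      exact le_trans (by linarith) (le_abs_self _)
    have hlm : (0 : ℝ) < l m := by exact_mod_cast hl m
    have hlL : (l m : ℝ) ≤ L := by exact_mod_cast hL m
    have hnn := (hpsi _ (h0 m fun k => B k ω) (h1 m fun k => B k ω)).1
    dsimp only
    calc c / L * ((f m fun k => B k ω) * (1 - f m fun k => B k ω) ^ 2)
        = 1 / L * (c * ((f m fun k => B k ω) * (1 - f m fun k => B k ω) ^ 2)) := by ring
      _ ≤ 1 / (l m : ℝ) * (c * ((f m fun k => B k ω) * (1 - f m fun k => B k ω) ^ 2)) :=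
        mul_le_mul_of_nonneg_right (one_div_le_one_div_of_le hlm hlL) (by positivity)
      _ ≤ _ := mul_le_mul_of_nonneg_left hle (by positivity)
  -- Mean increments tend to zero, so the limiting mean of `X (1 - X) ^ 2` is at most zero; an
  -- inequality holding infinitely often suffices for this.
  have hle := ge_of_tendsto_of_frequently (hlim2.sub (hlim1.const_mul (c / L))) hfreq
  have hnn : 0 ≤ᵐ[P] fun ω => X ω * (1 - X ω) ^ 2 := by
    filter_upwards [hX0, hX1] with ω h h'
    exact (hpsi _ h h').1
  have hint : Integrable (fun ω => X ω * (1 - X ω) ^ 2) P := by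
    refine Integrable.of_bound
      (hXm.mul ((measurable_const.sub hXm).pow_const 2)).aestronglyMeasurable 1 ?_
    filter_upwards [hX0, hX1] with ω h h'
    rw [Real.norm_of_nonneg (hpsi _ h h').1]; exact (hpsi _ h h').2
  have hzero : ∫ ω, X ω * (1 - X ω) ^ 2 ∂P = 0 := by
    refine le_antisymm ?_ (integral_nonneg_of_ae hnn)
    have : 0 < c / L := by positivity
    by_contra hcon
    have := mul_pos this (not_le.1 hcon)
    linarith
  have h01 : ∀ᵐ ω ∂P, X ω = 0 ∨ X ω = 1 := by
    filter_upwards [(integral_eq_zero_iff_of_nonneg_ae hnn hint).1 hzero] with ω h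
    rcases mul_eq_zero.1 h with h | h
    · exact Or.inl h
    · exact Or.inr (by linarith [pow_eq_zero_iff (two_ne_zero) |>.1 h])
  have hA : MeasurableSet {ω | X ω = 1} := hXm (measurableSet_singleton 1)
  refine ⟨{ω | X ω = 1}, hA, ?_, ?_, ?_⟩
  · have hmean : ∀ m, ∫ ω, (f m fun k => B k ω) ∂P = a := by
      intro m
      induction m with
      | zero => simp [ha]
      | succ m ih =>
        rw [integral_eq_integral_average hBm hBi hBu (hf (m + 1)), ← ih]
        refine integral_congr_ae (ae_of_all _ fun ω => ?_)
        have : (l m : ℝ) ≠ 0 := by exact_mod_cast (hl m).ne'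
        simp only [hsum]
        field_simp
    have hlim3 : Tendsto (fun m => ∫ ω, (f m fun k => B k ω) ∂P) atTop (𝓝 (∫ ω, X ω ∂P)) := by
      refine tendsto_integral_of_dominated_convergence (fun _ => 1)
        (fun m => (hm m).aestronglyMeasurable)
        (integrable_const _) (fun m => ae_of_all _ fun ω => ?_) hX
      rw [Real.norm_of_nonneg (h0 _ _)]; exact h1 _ _
    simp only [hmean] at hlim3
    rw [tendsto_nhds_unique tendsto_const_nhds hlim3, ← integral_indicator_one hA]
    refine integral_congr_ae ?_
    filter_upwards [h01] with ω h
    rcases h with h | h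
    · simp [h]
    · simp [h]
  · filter_upwards [hX] with ω h hω
    rwa [show X ω = 1 from hω] at h
  · filter_upwards [hX, h01] with ω h h' hω
    rwa [h'.resolve_right hω] at h

/-- The strong law of large numbers for uniformly bounded functions of the digits. -/
lemma ae_tendsto_average (hBm : ∀ k, Measurable (B k)) (hBi : iIndepFun B P)
    (hBu : ∀ k b, P.real (B k ⁻¹' {b}) = 1 / (l k : ℝ)) {g : ∀ k, Fin (l k) → ℝ} {C : ℝ}
    (hC : ∀ k i, |g k i| ≤ C) :
    ∀ᵐ ω ∂P, Tendsto (fun m : ℕ => (∑ k ∈ Finset.range m,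
      (g k (B k ω) - 1 / (l k : ℝ) * ∑ i, g k i)) / m) atTop (𝓝 0) := by
  have hmean : ∀ k, ∫ ω, g k (B k ω) ∂P = 1 / (l k : ℝ) * ∑ i, g k i := by
    intro k
    have hdep : DependsOn (fun b : ∀ k, Fin (l k) => g k (b k)) (Set.Iio (k + 1)) := by
      intro b b' h
      simp only [h k (Nat.lt_succ_self k)]
    have := integral_eq_integral_average hBm hBi hBu hdep
    simpa using this
  have hC0 : 0 ≤ C := (abs_nonneg _).trans (hC 0 (B 0 (Classical.choice
    (P.nonempty_of_neZero))))
  have hgm : ∀ k, Measurable fun ω => g k (B k ω) := fun k =>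
    (measurable_of_countable (g k)).comp (hBm k)
  -- The terms need not be identically distributed. Being bounded, they are subgaussian by
  -- Hoeffding's lemma, and exponential tails with Borel–Cantelli give the strong law.
  let X : ℕ → Ω → ℝ := fun k ω => g k (B k ω) - ∫ ω, g k (B k ω) ∂P
  let c : NNReal := (‖C - -C‖₊ / 2) ^ 2
  have hsub : ∀ k, HasSubgaussianMGF (X k) c P := fun k =>
    hasSubgaussianMGF_of_mem_Icc (hgm k).aemeasurable (ae_of_all _ fun ω => abs_le.1 (hC k _))
  have hind : iIndepFun X P :=
    hBi.comp (fun k i => g k i - ∫ ω, g k (B k ω) ∂P) fun k => measurable_of_countable _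
  have htail : ∀ X : ℕ → Ω → ℝ, iIndepFun X P → (∀ k, HasSubgaussianMGF (X k) c P) → ∀ ε : ℝ,
      0 < ε → ∀ᵐ ω ∂P, ∀ᶠ m : ℕ in atTop, ∑ k ∈ Finset.range m, X k ω < ε * m := by
    intro X hind hsub ε hε
    have hb : ∀ m : ℕ, P {ω | ε * m ≤ ∑ k ∈ Finset.range m, X k ω} ≤
        ENNReal.ofReal (Real.exp (-(ε ^ 2 / (2 * (c + 1)))) ^ m) := by
      intro m
      rw [← ofReal_measureReal (measure_ne_top _ _)]
      refine ENNReal.ofReal_le_ofReal ?_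
      -- The parameter is enlarged to `c + 1` because `c` may be zero, when the exponent `ε ^ 2 / (2
      -- c)` would be the default value `0` and give no decay.
      have hsub' : ∀ k < m, HasSubgaussianMGF (X k) (c + 1) P := fun k _ =>
        ⟨(hsub k).integrable_exp_mul, fun t => ((hsub k).mgf_le t).trans
          (Real.exp_le_exp.2 (by push_cast; nlinarith [sq_nonneg t]))⟩
      refine (HasSubgaussianMGF.measure_sum_range_ge_le_of_iIndepFun hind hsub'
        (by positivity)).trans_eq ?_
      rw [← Real.exp_nat_mul]
      congr 1
      push_cast
      rcases Nat.eq_zero_or_pos m with rfl | hm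
      · simp
      · have : (m : ℝ) ≠ 0 := by exact_mod_cast hm.ne'
        have : (c : ℝ) + 1 ≠ 0 := by positivity
        field_simp
    have hq : Real.exp (-(ε ^ 2 / (2 * (c + 1)))) < 1 := by
      rw [Real.exp_lt_one_iff, neg_lt_zero]; positivity
    have hsum := ae_eventually_notMem (μ := P)
      (s := fun m : ℕ => {ω | ε * m ≤ ∑ k ∈ Finset.range m, X k ω})
      (ne_top_of_le_ne_top (summable_geometric_of_lt_one (Real.exp_nonneg _) hq).tsum_ofReal_ne_top
        (ENNReal.tsum_le_tsum hb))
    filter_upwards [hsum] with ω h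
    exact h.mono fun m hm => not_le.1 hm
  have hnegX : iIndepFun (fun k ω => -X k ω) P :=
    hind.comp (fun _ x => -x) fun _ => measurable_neg
  have hup : ∀ᵐ ω ∂P, ∀ j : ℕ, ∀ᶠ m : ℕ in atTop,
      ∑ k ∈ Finset.range m, X k ω < 1 / (j + 1 : ℝ) * m :=
    ae_all_iff.2 fun j => htail X hind hsub _ (by positivity)
  have hdown : ∀ᵐ ω ∂P, ∀ j : ℕ, ∀ᶠ m : ℕ in atTop,
      ∑ k ∈ Finset.range m, -X k ω < 1 / (j + 1 : ℝ) * m :=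
    ae_all_iff.2 fun j => htail _ hnegX (fun k => (hsub k).neg) _ (by positivity)
  filter_upwards [hup, hdown] with ω h1 h2
  rw [Metric.tendsto_atTop']
  intro ε hε
  obtain ⟨j, hj⟩ := exists_nat_one_div_lt hε
  obtain ⟨N, hN⟩ := ((h1 j).and (h2 j)).exists_forall_of_atTop
  refine ⟨N, fun m hm => ?_⟩
  obtain ⟨h3, h4⟩ := hN m hm.le
  have hm0 : (0 : ℝ) < m := by exact_mod_cast (Nat.zero_le N).trans_lt hm
  rw [Finset.sum_neg_distrib] at h4
  simp only [X, hmean] at h3 h4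
  rw [Real.dist_eq, sub_zero, abs_div, abs_of_pos hm0, div_lt_iff₀ hm0, abs_lt]
  have := mul_lt_mul_of_pos_right hj hm0
  constructor <;> linarith

end Digits

/-! ### Growth of the exponent along a path -/

section Growth

variable {z : ℕ → ℝ} {d : ℕ → ℕ} {N : ℕ → ℝ} {γ Λ e : ℝ}

lemma rpow_eq_two_rpow {x : ℝ} (hx : 0 < x) (γ : ℝ) : x ^ γ = 2 ^ (γ * Real.logb 2 x) := by
  rw [mul_comm, Real.rpow_mul zero_le_two, Real.rpow_logb two_pos (by norm_num) hx]

lemma eventually_add_le_of_tendsto_div {a b : ℕ → ℝ} {A B : ℝ}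
    (ha : Tendsto (fun m : ℕ => a m / m) atTop (𝓝 A)) (hb : Tendsto (fun m : ℕ => b m / m) atTop (𝓝 B))
    (hAB : A < B) (C : ℝ) : ∀ᶠ m in atTop, a m + C ≤ b m := by
  have h := (ha.add (tendsto_const_div_atTop_nhds_zero_nat C)).eventually_lt hb (by simpa using hAB)
  filter_upwards [h, eventually_gt_atTop 0] with m hm hm0
  have hm0' : (0 : ℝ) < m := by exact_mod_cast hm0
  rw [← add_div] at hm
  exact ((div_lt_div_iff_of_pos_right hm0').1 hm).le

lemma pow_prod_le (hz : ∀ m, 0 ≤ z m) (hd : ∀ m, z m ^ d m ≤ z (m + 1)) (m : ℕ) :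
    z 0 ^ ∏ k ∈ Finset.range m, d k ≤ z m := by
  induction m with
  | zero => simp
  | succ m ih =>
    rw [Finset.prod_range_succ, pow_mul]
    exact (pow_le_pow_left₀ (pow_nonneg (hz 0) _) ih _).trans (hd m)

/-- Iterating gives `-log₂ z m ≤ (∏ d k) * (-log₂ (z 0))`. The logarithm of the right side grows at
rate `e` per step, below the rate `γ Λ` of `log₂ (N m ^ γ)`. -/
lemma eventually_two_rpow_neg_le (hz0 : 0 < z 0) (hz : ∀ m, 0 ≤ z m) (hd1 : ∀ m, 1 ≤ d m)
    (hd : ∀ m, z m ^ d m ≤ z (m + 1)) (hN : ∀ m, 0 < N m)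
    (he : Tendsto (fun m : ℕ => (∑ k ∈ Finset.range m, Real.logb 2 (d k)) / m) atTop (𝓝 e))
    (hΛ : Tendsto (fun m : ℕ => Real.logb 2 (N m) / m) atTop (𝓝 Λ)) (hγ : e < γ * Λ) :
    ∀ᶠ m in atTop, (2 : ℝ) ^ (-(N m ^ γ)) ≤ z m := by
  have hΛ' : Tendsto (fun m : ℕ => γ * Real.logb 2 (N m) / m) atTop (𝓝 (γ * Λ)) := by
    simpa only [mul_div_assoc] using hΛ.const_mul γ
  -- The maximum with `1` keeps the logarithm of `K` meaningful when `z 0 ≥ 1`.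
  set K := max (-Real.logb 2 (z 0)) 1
  have hK : 0 < K := lt_max_of_lt_right one_pos
  filter_upwards [eventually_add_le_of_tendsto_div he hΛ' hγ (Real.logb 2 K)] with m hm
  refine le_trans ?_ (pow_prod_le hz hd m)
  have hdpos : ∀ k, (0 : ℝ) < d k := fun k => by exact_mod_cast hd1 k
  have h1 : (∏ k ∈ Finset.range m, (d k : ℝ)) * K ≤ N m ^ γ := by
    have hprod : (0 : ℝ) < ∏ k ∈ Finset.range m, (d k : ℝ) := Finset.prod_pos fun k _ => hdpos k
    rw [rpow_eq_two_rpow (hN m), ← Real.logb_le_iff_le_rpow one_lt_two (by positivity),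
      Real.logb_mul hprod.ne' hK.ne', Real.logb_prod _ _ fun k _ => (hdpos k).ne']
    exact hm
  have h2 : (∏ k ∈ Finset.range m, (d k : ℝ)) * -Real.logb 2 (z 0) ≤ N m ^ γ :=
    (mul_le_mul_of_nonneg_left (le_max_left _ _)
      (Finset.prod_nonneg fun k _ => (hdpos k).le)).trans h1
  rw [← Real.le_logb_iff_rpow_le one_lt_two (pow_pos hz0 _), Real.logb_pow]
  push_cast
  linarith

/-- For `L = -log₂ z` the recursion reads `L (m + 1) ≥ d m * L m - c`. Since `z → 0`, eventually `L
≥ c / ε` for good, and then `L (m + 1) ≥ (d m - ε) * L m`. -/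
lemma eventually_le_two_rpow_neg (hz : ∀ m, 0 < z m) (hz0 : Tendsto z atTop (𝓝 0)) {c : ℕ}
    (hd : ∀ m, z (m + 1) ≤ 2 ^ c * z m ^ d m) (hd1 : ∀ m, 1 ≤ d m) {ε : ℝ} (hε : 0 < ε)
    (hε1 : ε < 1) (hN : ∀ m, 0 < N m)
    (he : Tendsto (fun m : ℕ => (∑ k ∈ Finset.range m, Real.logb 2 (d k - ε)) / m) atTop (𝓝 e))
    (hΛ : Tendsto (fun m : ℕ => Real.logb 2 (N m) / m) atTop (𝓝 Λ)) (hγ : γ * Λ < e) :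
    ∀ᶠ m in atTop, z m ≤ (2 : ℝ) ^ (-(N m ^ γ)) := by
  have hΛ' : Tendsto (fun m : ℕ => γ * Real.logb 2 (N m) / m) atTop (𝓝 (γ * Λ)) := by
    simpa only [mul_div_assoc] using hΛ.const_mul γ
  let L : ℕ → ℝ := fun m => -Real.logb 2 (z m)
  have hL : ∀ m, d m * L m - c ≤ L (m + 1) := by
    intro m
    have h := Real.logb_le_logb_of_le one_lt_two (hz (m + 1)) (hd m)
    rw [Real.logb_mul (by positivity) (pow_pos (hz m) _).ne', Real.logb_pow, Real.logb_pow,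
      Real.logb_self_eq_one one_lt_two] at h
    simp only [L]
    linarith
  -- The bound `c / ε` absorbs the constant; the bound `1` makes `log₂ (L m₀)` nonnegative at the
  -- start of the induction.
  set M : ℝ := max (c / ε) 1
  have hM : ∀ᶠ m in atTop, M ≤ L m := by
    have hpos : (0 : ℝ) < 2 ^ (-M) := Real.rpow_pos_of_pos two_pos _
    filter_upwards [hz0.eventually_lt_const hpos] with m hm
    have := (Real.logb_lt_iff_lt_rpow one_lt_two (hz m)).2 hm
    simp only [L]
    linarith
  obtain ⟨m₀, hm₀⟩ := hM.exists_forall_of_atTop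
  have hgrow : ∀ m, m₀ ≤ m → ∑ k ∈ Finset.range m, Real.logb 2 (d k - ε) -
      ∑ k ∈ Finset.range m₀, Real.logb 2 (d k - ε) ≤ Real.logb 2 (L m) := by
    intro m hm
    induction m, hm using Nat.le_induction with
    | base =>
      rw [sub_self]
      exact Real.logb_nonneg one_lt_two ((le_max_right _ _).trans (hm₀ m₀ le_rfl))
    | succ m hm ih =>
      have hLm := hm₀ m hm
      have hLpos : 0 < L m := one_pos.trans_le ((le_max_right _ _).trans hLm)
      have hdε : 0 < (d m : ℝ) - ε := by
        have : (1 : ℝ) ≤ d m := by exact_mod_cast hd1 m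
        linarith
      have h1 : (c : ℝ) ≤ L m * ε := (div_le_iff₀ hε).1 ((le_max_left _ _).trans hLm)
      have h2 : ((d m : ℝ) - ε) * L m ≤ L (m + 1) := by linarith [hL m]
      have h3 := Real.logb_le_logb_of_le one_lt_two (mul_pos hdε hLpos) h2
      rw [Real.logb_mul hdε.ne' hLpos.ne'] at h3
      rw [Finset.sum_range_succ]
      linarith
  filter_upwards [eventually_add_le_of_tendsto_div hΛ' he hγ
    (∑ k ∈ Finset.range m₀, Real.logb 2 (d k - ε)), eventually_ge_atTop m₀] with m hm hm'
  have hLpos : 0 < L m := one_pos.trans_le ((le_max_right _ _).trans (hm₀ m hm'))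
  have h1 : N m ^ γ ≤ L m := by
    rw [rpow_eq_two_rpow (hN m), ← Real.le_logb_iff_rpow_le one_lt_two hLpos]
    linarith [hgrow m hm']
  rw [← Real.logb_le_iff_le_rpow one_lt_two (hz m)]
  simp only [L] at h1
  linarith

end Growth

/-! ### Sequences with asymptotic frequencies -/

section Frequencies

variable {s : ℕ} {κ : ℕ → Fin s} {p : Fin s → ℝ}

lemma tendsto_average_of_frequencies
    (hp : ∀ j, Tendsto (fun m : ℕ => (((Finset.range m).filter fun k => κ k = j).card : ℝ) / m)
      atTop (𝓝 (p j))) (φ : Fin s → ℝ) :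
    Tendsto (fun m : ℕ => (∑ k ∈ Finset.range m, φ (κ k)) / m) atTop (𝓝 (∑ j, p j * φ j)) := by
  refine (tendsto_finsetSum _ fun j _ => (hp j).mul_const (φ j)).congr fun m => ?_
  rw [← Finset.sum_fiberwise (Finset.range m) κ, Finset.sum_div]
  refine Finset.sum_congr rfl fun j _ => ?_
  rw [Finset.sum_congr rfl (g := fun _ => φ j) fun k hk => by rw [(Finset.mem_filter.1 hk).2],
    Finset.sum_const, nsmul_eq_mul]
  ring

lemma sum_frequencies
    (hp : ∀ j, Tendsto (fun m : ℕ => (((Finset.range m).filter fun k => κ k = j).card : ℝ) / m)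
      atTop (𝓝 (p j))) : ∑ j, p j = 1 := by
  have h := tendsto_average_of_frequencies hp fun _ => 1
  simp only [mul_one, Finset.sum_const, Finset.card_range, nsmul_eq_mul] at h
  refine tendsto_nhds_unique h (tendsto_const_nhds.congr' ?_)
  filter_upwards [eventually_gt_atTop 0] with m hm
  have : (m : ℝ) ≠ 0 := by exact_mod_cast hm.ne'
  field_simp

lemma frequency_nonneg
    (hp : ∀ j, Tendsto (fun m : ℕ => (((Finset.range m).filter fun k => κ k = j).card : ℝ) / m)
      atTop (𝓝 (p j))) (j : Fin s) : 0 ≤ p j :=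
  ge_of_tendsto' (hp j) fun m => by positivity

lemma frequently_eq_of_frequency_ne_zero {j : Fin s}
    (hp : Tendsto (fun m : ℕ => (((Finset.range m).filter fun k => κ k = j).card : ℝ) / m)
      atTop (𝓝 (p j))) (hj : p j ≠ 0) : ∃ᶠ k in atTop, κ k = j := by
  intro h
  obtain ⟨M, hM⟩ := h.exists_forall_of_atTop
  refine hj (tendsto_nhds_unique hp ?_)
  refine squeeze_zero (fun m => by positivity) (fun m => ?_)
    (tendsto_const_div_atTop_nhds_zero_nat (M : ℝ))
  refine div_le_div_of_nonneg_right ?_ (Nat.cast_nonneg m)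
  have : ((Finset.range m).filter fun k => κ k = j) ⊆ Finset.range M := fun k hk => by
    rw [Finset.mem_range]
    by_contra hlt
    exact hM k (not_lt.1 hlt) (Finset.mem_filter.1 hk).2
  exact_mod_cast (Finset.card_le_card this).trans_eq (Finset.card_range M)

variable {Ω : Type*} [MeasurableSpace Ω] {P : Measure Ω} [IsProbabilityMeasure P] {l : Fin s → ℕ}
  {B : ∀ k, Ω → Fin (l (κ k))}

/-- The law of large numbers handles the fluctuations, the asymptotic frequencies the means. -/
lemma ae_tendsto_average_of_frequencies
    (hp : ∀ j, Tendsto (fun m : ℕ => (((Finset.range m).filter fun k => κ k = j).card : ℝ) / m)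
      atTop (𝓝 (p j))) (hBm : ∀ k, Measurable (B k)) (hBi : iIndepFun B P)
    (hBu : ∀ k b, P.real (B k ⁻¹' {b}) = 1 / (l (κ k) : ℝ)) (h : ∀ j, Fin (l j) → ℝ) :
    ∀ᵐ ω ∂P, Tendsto (fun m : ℕ => (∑ k ∈ Finset.range m, h (κ k) (B k ω)) / m) atTop
      (𝓝 (∑ j, p j * (1 / (l j : ℝ) * ∑ i, h j i))) := by
  have hlln := ae_tendsto_average (g := fun k => h (κ k)) (C := ∑ j, ∑ i, |h j i|) hBm hBi hBu
    fun k i => (Finset.single_le_sum (f := fun i => |h (κ k) i|) (fun _ _ => abs_nonneg _)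
      (Finset.mem_univ i)).trans (Finset.single_le_sum (f := fun j => ∑ i, |h j i|)
      (fun _ _ => Finset.sum_nonneg fun _ _ => abs_nonneg _) (Finset.mem_univ (κ k)))
  filter_upwards [hlln] with ω hω
  have := hω.add (tendsto_average_of_frequencies hp fun j => 1 / (l j : ℝ) * ∑ i, h j i)
  rw [zero_add] at this
  refine this.congr fun m => ?_
  rw [← add_div, ← Finset.sum_add_distrib]
  simp

end Frequencies

/-! ### Block lengths, error exponents and the rate of convergence. -/

lemma blockLength_pos {l : ℕ → ℕ} (hl : ∀ k, 0 < l k) (m : ℕ) : 0 < blockLength l m :=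
  Finset.prod_pos fun k _ => hl k

lemma logb_blockLength {l : ℕ → ℕ} (hl : ∀ k, 0 < l k) (m : ℕ) :
    Real.logb 2 (blockLength l m) = ∑ k ∈ Finset.range m, Real.logb 2 (l k) := by
  rw [blockLength, Nat.cast_prod, Real.logb_prod _ _ fun k _ => by exact_mod_cast (hl k).ne',
    Fin.sum_univ_eq_sum_range fun k => Real.logb 2 (l k)]

/-- Change of base. It identifies `E * Λ` with the almost sure average of `log₂` of the partial
distances along a path. -/
lemma logb_mul_errorExponent {n : ℕ} (hn : 2 ≤ n) (T : Matrix (Fin n) (Fin n) (ZMod 2)) :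
    Real.logb 2 n * errorExponent T =
      1 / (n : ℝ) * ∑ i, Real.logb 2 (partialDistance T i) := by
  have h1 : (1 : ℝ) < n := by exact_mod_cast hn
  rw [errorExponent, mul_left_comm, Finset.mul_sum]
  congr 1
  exact Finset.sum_congr rfl fun i _ => Real.mul_logb (by positivity) h1.ne' (by linarith)

lemma exists_two_le_partialDistance {n : ℕ} {T : Matrix (Fin n) (Fin n) (ZMod 2)} (hT : IsUnit T)
    (h : errorExponent T ≠ 0) : ∃ i, 2 ≤ partialDistance T i := by
  by_contra! hD
  refine h ?_
  have : ∀ i, partialDistance T i = 1 := fun i =>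
    le_antisymm (Nat.le_of_lt_succ (hD i)) (one_le_partialDistance hT i)
  simp [errorExponent, this]

end MultiKernelPolar

open MultiKernelPolar

theorem theorem2 {Y Ω : Type*} [MeasurableSpace Ω] (P : Measure Ω) [IsProbabilityMeasure P]
    -- the channel
    (W : ZMod 2 → Y → ℝ) (hW : MultiKernelPolar.IsBinaryChannel W)
    (hW₀ : 0 < MultiKernelPolar.bhattacharyya W)
    -- the constituent kernels
    (s : ℕ) (l : Fin s → ℕ) (hl : ∀ j, 2 ≤ l j)
    (T : ∀ j, Matrix (Fin (l j)) (Fin (l j)) (ZMod 2)) (hT : ∀ j, IsUnit (T j))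
    -- the kernel used at each step, and the asymptotic frequencies
    (κ : ℕ → Fin s) (p : Fin s → ℝ)
    (hp : ∀ j, Tendsto (fun m : ℕ => (((Finset.range m).filter fun k => κ k = j).card : ℝ) / m)
      atTop (𝓝 (p j)))
    -- the independent, uniformly distributed indices
    (B : ∀ k, Ω → Fin (l (κ k))) (hBm : ∀ k, Measurable (B k)) (hBi : iIndepFun B P)
    (hBu : ∀ k b, P.real (B k ⁻¹' {b}) = 1 / (l (κ k) : ℝ)) :
    MultiKernelPolar.HasRateOfConvergence P W (fun k => T (κ k)) B
      (∑ j, p j * Real.logb 2 (l j) / (∑ j', p j' * Real.logb 2 (l j')) *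
        MultiKernelPolar.errorExponent (T j)) := by
  set Λ := ∑ j, p j * Real.logb 2 (l j) with hΛdef
  set E := ∑ j, p j * Real.logb 2 (l j) / Λ * errorExponent (T j) with hE
  have hlκ : ∀ k, 0 < l (κ k) := fun k => two_pos.trans_le (hl _)
  have hTκ : ∀ k, IsUnit (T (κ k)) := fun k => hT _
  have hlog : ∀ j, 1 ≤ Real.logb 2 (l j) := fun j => by
    rw [Real.le_logb_iff_rpow_le one_lt_two (by exact_mod_cast two_pos.trans_le (hl j)),
      Real.rpow_one]
    exact_mod_cast hl j
  have hp0 := frequency_nonneg hp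
  have hΛpos : 0 < Λ := by
    refine one_pos.trans_le ?_
    rw [← sum_frequencies hp]
    exact Finset.sum_le_sum fun j _ => le_mul_of_one_le_right (hp0 j) (hlog j)
  have hEΛ : E * Λ = ∑ j, p j * (1 / (l j : ℝ) * ∑ i, Real.logb 2 (partialDistance (T j) i)) := by
    rw [hE, Finset.sum_mul]
    refine Finset.sum_congr rfl fun j _ => ?_
    rw [← logb_mul_errorExponent (hl j)]
    field_simp
  have hN : Tendsto (fun m : ℕ => Real.logb 2 (blockLength (fun k => l (κ k)) m) / m) atTop
      (𝓝 Λ) := by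
    simpa only [logb_blockLength hlκ] using tendsto_average_of_frequencies hp fun j =>
      Real.logb 2 (l j)
  have hNpos : ∀ m, (0 : ℝ) < blockLength (fun k => l (κ k)) m := fun m => by
    exact_mod_cast blockLength_pos hlκ m
  have hZm : ∀ m, Measurable (bhattacharyyaProcess W (fun k => T (κ k)) B m) := fun m =>
    measurable_of_dependsOn hBm (treeBhattacharyya_dependsOn (W := W) (T := fun k => T (κ k)) m)
  have hZ0 : ∀ ω, bhattacharyyaProcess W (fun k => T (κ k)) B 0 ω = bhattacharyya W := fun ω =>
    treeBhattacharyya_zero (T := fun k => T (κ k)) fun k => B k ω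
  have hZlow : ∀ m ω, bhattacharyyaProcess W (fun k => T (κ k)) B m ω ^
      partialDistance (T (κ m)) (B m ω) ≤ bhattacharyyaProcess W (fun k => T (κ k)) B (m + 1) ω :=
    fun m ω => pow_le_treeBhattacharyya_succ hW hTκ m fun k => B k ω
  have hZup : ∀ m ω, bhattacharyyaProcess W (fun k => T (κ k)) B (m + 1) ω ≤ 2 ^ l (κ m) *
      bhattacharyyaProcess W (fun k => T (κ k)) B m ω ^ partialDistance (T (κ m)) (B m ω) :=
    fun m ω => treeBhattacharyya_succ_le hW hTκ m fun k => B k ω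
  -- Positivity of `Z(W)` propagates along the tree, so all logarithms of `Z_m` are genuine.
  have hZpos : ∀ m ω, 0 < bhattacharyyaProcess W (fun k => T (κ k)) B m ω := by
    intro m ω
    induction m with
    | zero => rw [hZ0]; exact hW₀
    | succ m ih => exact (pow_pos ih _).trans_le (hZlow m ω)
  have hD1 : ∀ m ω, 1 ≤ partialDistance (T (κ m)) (B m ω) := fun m ω =>
    one_le_partialDistance (hT _) _
  obtain ⟨c, hc⟩ : ∃ c, ∀ j, l j ≤ c := ⟨∑ j, l j, fun j =>
    Finset.single_le_sum (fun _ _ => Nat.zero_le _) (Finset.mem_univ j)⟩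
  constructor
  · intro γ hγ
    have hae : ∀ᵐ ω ∂P, ∀ᶠ m in atTop, (2 : ℝ) ^ (-((blockLength (fun k => l (κ k)) m : ℝ) ^ γ)) ≤
        bhattacharyyaProcess W (fun k => T (κ k)) B m ω := by
      filter_upwards [ae_tendsto_average_of_frequencies hp hBm hBi hBu fun j i =>
        Real.logb 2 (partialDistance (T j) i)] with ω hω
      rw [← hEΛ] at hω
      exact eventually_two_rpow_neg_le (z := fun m => bhattacharyyaProcess W (fun k => T (κ k)) B m ω)
        (hZpos 0 ω) (fun m => (hZpos m ω).le) (fun m => hD1 m ω) (fun m => hZlow m ω) hNpos hω hN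
        (mul_lt_mul_of_pos_right hγ hΛpos)
    have := tendsto_measure_of_ae_tendsto_indicator_of_isFiniteMeasure (μ := P) atTop
      MeasurableSet.univ (fun m => measurableSet_le measurable_const (hZm m))
      (hae.mono fun ω h => h.mono fun m hm => iff_of_true hm trivial)
    rw [← probReal_univ (μ := P)]
    exact (ENNReal.tendsto_toReal (measure_ne_top P _)).comp this
  · intro γ hγ0 hγ
    -- As `0 < γ < E`, some kernel of nonzero frequency has a nonzero exponent. It occurs infinitely
    -- often and provides the jumps.
    obtain ⟨j, hj, hEj⟩ : ∃ j, p j ≠ 0 ∧ errorExponent (T j) ≠ 0 := by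
      by_contra! hcon
      have : E = 0 := Finset.sum_eq_zero fun j _ => by
        by_cases h : p j = 0
        · simp [h]
        · simp [hcon j h]
      linarith
    obtain ⟨i₀, hi₀⟩ := exists_two_le_partialDistance (hT j) hEj
    have hjump : ∃ᶠ m in atTop, ∀ b, ∃ i,
        treeInfo W (fun k => T (κ k)) m b + Real.log 2 ^ 2 / 4 *
          (treeInfo W (fun k => T (κ k)) m b * (1 - treeInfo W (fun k => T (κ k)) m b) ^ 2) ≤
        treeInfo W (fun k => T (κ k)) (m + 1) (Function.update b m i) := by
      refine (frequently_eq_of_frequency_ne_zero (hp j) hj).mono fun m hm b => ?_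
      refine exists_treeInfo_update_ge hW hTκ ?_ b
      rw [hm]
      exact ⟨i₀, hi₀⟩
    obtain ⟨A, hA, hPA, hA1, hA0⟩ := exists_ae_tendsto_zero_or_one hBm hBi hBu hlκ
      (fun k => hc (κ k)) (treeInfo_dependsOn (W := W) (T := fun k => T (κ k)))
      (treeInfo_nonneg hW hTκ) (treeInfo_le_one hW hTκ) (sum_treeInfo_update hW hTκ)
      (div_pos (pow_pos (Real.log_pos one_lt_two) 2) (by norm_num : (0 : ℝ) < 4)) hjump
      (treeInfo_zero hW)
    -- At `ε = 0` the sum is `E * Λ > γ * Λ`; continuity leaves room to lose a small `ε` in every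
    -- partial distance.
    obtain ⟨ε, hε0, hε1, hε⟩ : ∃ ε : ℝ, 0 < ε ∧ ε < 1 ∧ γ * Λ <
        ∑ j, p j * (1 / (l j : ℝ) * ∑ i, Real.logb 2 (partialDistance (T j) i - ε)) := by
      have hcont : ContinuousAt (fun ε : ℝ => ∑ j, p j * (1 / (l j : ℝ) *
          ∑ i, Real.logb 2 (partialDistance (T j) i - ε))) 0 := by
        refine tendsto_finsetSum _ fun j _ => Tendsto.const_mul _ (Tendsto.const_mul _
          (tendsto_finsetSum _ fun i _ => ?_))
        have : (partialDistance (T j) i : ℝ) - 0 ≠ 0 := by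
          have := one_le_partialDistance (hT j) i
          rw [sub_zero]
          exact_mod_cast (Nat.one_le_iff_ne_zero.1 this)
        exact (tendsto_const_nhds.sub tendsto_id).logb this
      have hlt : γ * Λ < ∑ j, p j * (1 / (l j : ℝ) *
          ∑ i, Real.logb 2 (partialDistance (T j) i - 0)) := by
        simp only [sub_zero, ← hEΛ]
        exact mul_lt_mul_of_pos_right hγ hΛpos
      have h1 := (hcont.eventually (lt_mem_nhds hlt)).filter_mono (nhdsWithin_le_nhds (s := Set.Ioi 0))
      have h2 : ∀ᶠ ε : ℝ in 𝓝[>] 0, ε ∈ Set.Ioo (0 : ℝ) 1 := Ioo_mem_nhdsGT one_pos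
      obtain ⟨ε, h3, h4⟩ := (h1.and h2).exists
      exact ⟨ε, h4.1, h4.2, h3⟩
    -- On almost every path the event eventually agrees with `A`, so its probability tends to that
    -- of `A`, which is `I(W)`.
    have hae : ∀ᵐ ω ∂P, ∀ᶠ m in atTop, ω ∈ {ω | bhattacharyyaProcess W (fun k => T (κ k)) B m ω ≤
        (2 : ℝ) ^ (-((blockLength (fun k => l (κ k)) m : ℝ) ^ γ))} ↔ ω ∈ A := by
      filter_upwards [hA1, hA0, ae_tendsto_average_of_frequencies hp hBm hBi hBu fun j i =>
        Real.logb 2 (partialDistance (T j) i - ε)] with ω h1 h0 hω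
      by_cases hωA : ω ∈ A
      · have hz : Tendsto (fun m => bhattacharyyaProcess W (fun k => T (κ k)) B m ω) atTop (𝓝 0) := by
          have hsq : Tendsto (fun m => bhattacharyyaProcess W (fun k => T (κ k)) B m ω ^ 2) atTop
              (𝓝 0) := by
            refine squeeze_zero (fun m => sq_nonneg _)
              (fun m => sq_treeBhattacharyya_le hW hTκ m fun k => B k ω) ?_
            simpa using (((tendsto_const_nhds (x := (1 : ℝ))).sub (h1 hωA)).mul_const
              (Real.log 2)).const_mul 2
          have := hsq.sqrt
          simpa [Real.sqrt_sq (hZpos _ ω).le] using this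
        refine (eventually_le_two_rpow_neg
          (z := fun m => bhattacharyyaProcess W (fun k => T (κ k)) B m ω) (c := c)
          (fun m => hZpos m ω) hz (fun m => (hZup m ω).trans ?_) (fun m => hD1 m ω) hε0 hε1 hNpos hω
          hN hε).mono fun m hm => iff_of_true hm hωA
        exact mul_le_mul_of_nonneg_right (pow_le_pow_right₀ one_le_two (hc _))
          (pow_nonneg (hZpos m ω).le _)
      -- Off `A` the information tends to `0`, which keeps `Z_m` above `log 2 / 2`, while the
      -- threshold tends to zero because `γ > 0`.
      · have hlow : ∀ᶠ m in atTop, Real.log 2 / 2 <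
            bhattacharyyaProcess W (fun k => T (κ k)) B m ω := by
          have ht : Tendsto (fun m => (1 - treeInfo W (fun k => T (κ k)) m fun k => B k ω) *
              Real.log 2) atTop (𝓝 (Real.log 2)) := by
            simpa using ((tendsto_const_nhds (x := (1 : ℝ))).sub (h0 hωA)).mul_const (Real.log 2)
          filter_upwards [ht.eventually (lt_mem_nhds (half_lt_self (Real.log_pos one_lt_two)))]
            with m hm
          exact hm.trans_le (le_treeBhattacharyya hW hTκ m fun k => B k ω)
        have hNtop : Tendsto (fun m => (blockLength (fun k => l (κ k)) m : ℝ)) atTop atTop := by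
          refine tendsto_atTop_mono (fun m => ?_) (tendsto_pow_atTop_atTop_of_one_lt one_lt_two)
          have : 2 ^ m ≤ blockLength (fun k => l (κ k)) m := by
            have := Finset.prod_le_prod' (s := (Finset.univ : Finset (Fin m))) (f := fun _ => 2)
              fun k _ => hl (κ k)
            simpa [blockLength] using this
          exact_mod_cast this
        have hsmall : Tendsto (fun m => (2 : ℝ) ^
            (-((blockLength (fun k => l (κ k)) m : ℝ) ^ γ))) atTop (𝓝 0) :=
          (tendsto_rpow_atBot_of_base_gt_one 2 one_lt_two).comp
            (tendsto_neg_atTop_atBot.comp ((tendsto_rpow_atTop hγ0).comp hNtop))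
        filter_upwards [hlow, hsmall.eventually_lt_const
          (half_pos (Real.log_pos one_lt_two))] with m h3 h4
        exact iff_of_false (not_le.2 (h4.trans h3)) hωA
    have := tendsto_measure_of_ae_tendsto_indicator_of_isFiniteMeasure (μ := P) atTop hA
      (fun m => measurableSet_le (hZm m) measurable_const) hae
    rw [← hPA]
    exact (ENNReal.tendsto_toReal (measure_ne_top P _)).comp this
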